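/- Let $\mathcal M$ and $\mathcal W$ be finite sets of men and women and let $N=\min(|\mathcal M|,|\mathcal W|)$. Each person has a set of acceptable partners of the opposite sex and a strict preference list over them, and prefers every acceptable partner to being single and being single to every unacceptable partner. A matching is stable if no person is matched with an unacceptable partner and no man and woman each prefer the other to their own situation in the matching. A stable pair is a man-woman pair that belongs to at least one stable matching. The men's preference lists are arbitrary (deterministic). Each woman $w$ has a deterministic set of $d_w\ge 1$ acceptable men and gives a popularity $\mathcal D_w(m)>0$ to each acceptable man $m$. She builds her preference list by sampling without replacement: she draws her favourite man with probabilities proportional to the popularities, then her second favourite among the remaining acceptable men, again with probabilities proportional to the popularities, and so on. Different women draw their lists independently. (Only the ratios of the popularities given by one woman matter for her list; the popularities $\mathcal D_w$ may, but need not, be scaled to sum to $1$.) For each man $m$, let $r_m\ge 1$ be the ratio between the highest and the lowest popularity given to $m$ by some woman who finds him acceptable, with $r_m=1$ if there is no such woman. Then \[\mathbb E[\text{number of stable pairs}]\;\le\; N+\sum_{w\in\mathcal W}\ln d_w+\sum_{m\in\mathcal M}\ln r_m .\] Moreover, when all women agree on the popularities of men, that is, $\mathcal D_w(m)=\mathcal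 D_{w'}(m)$ whenever $w$ and $w'$ both find $m$ acceptable, then \[\mathbb E[\text{number of stable pairs}]\;\le\; N+N\ln N ,\] where $N\ln N$ is read as $0$ if $N=0$. -/

import Mathlib

open MeasureTheory ProbabilityTheory

/-! A matching between the set `M` of men and the set `W` of women is a partial bijection
`μ : M ≃. W`: man `m` is single when `μ m = none` and married to `w` when `μ m = some w`;
the partner of a woman `w` is `μ.symm w`. -/

/-- A preference list `l` enumerates the acceptable partners, favourite first.
`Prefers l x y` says that the owner of the list strictly prefers situation `x` to situation `y`,
where `some a` means being matched with `a` and `none` means being single.  Every listed partner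
is better than being single, which is better than every unlisted partner.
(`List.idxOf` of an unlisted element is the length of the list.) -/
def Prefers {α : Type*} [DecidableEq α] (l : List α) : Option α → Option α → Prop
  | some a, some b => l.idxOf a < l.idxOf b
  | some a, none => a ∈ l
  | none, some b => b ∉ l
  | none, none => False

/-- The matching `μ` is stable: nobody prefers to be single over the assigned partner, and no
man and woman prefer each other to their assigned situations. -/
def IsStableMatching {M W : Type*} [DecidableEq M] [DecidableEq W]
    (menPref : M → List W) (womenPref : W → List M) (μ : M ≃. W) : Prop :=
  (∀ m, ¬ Prefers (menPref m) none (μ m)) ∧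
  (∀ w, ¬ Prefers (womenPref w) none (μ.symm w)) ∧
  ∀ m w, ¬ (Prefers (womenPref w) (some m) (μ.symm w) ∧ Prefers (menPref m) (some w) (μ m))

/-- The man-woman pairs that belong to at least one stable matching. -/
def stablePairs {M W : Type*} [DecidableEq M] [DecidableEq W]
    (menPref : M → List W) (womenPref : W → List M) : Set (M × W) :=
  {p | ∃ μ : M ≃. W, IsStableMatching menPref womenPref μ ∧ μ p.1 = some p.2}

/-- One draw from the finite nonempty set `s`, with probabilities proportional to the positive
popularities `D`. -/
noncomputable def popularityDraw {α : Type*} (D : α → ℝ) (s : Finset α)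
    (hs : s.Nonempty) (hD : ∀ a ∈ s, 0 < D a) : PMF s :=
  PMF.ofFintype (fun a => ENNReal.ofReal (D a / ∑ b ∈ s, D b)) (by
    have hpos : 0 < ∑ b ∈ s, D b := Finset.sum_pos hD hs
    rw [← ENNReal.ofReal_sum_of_nonneg
      (fun (a : s) _ => div_nonneg (hD a a.2).le hpos.le), ← Finset.sum_div,
      Finset.sum_coe_sort s D, div_self hpos.ne', ENNReal.ofReal_one])

/-- The law of the preference list obtained by sampling without replacement from `s`: the
favourite partner is drawn with probabilities proportional to the popularities `D`, then the
second favourite among the remaining partners, and so on until the least favourite one. -/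
noncomputable def popularityLaw {α : Type*} [DecidableEq α] (D : α → ℝ) (s : Finset α)
    (hD : ∀ a ∈ s, 0 < D a) : PMF (List α) :=
  if hs : s.Nonempty then
    (popularityDraw D s hs hD).bind fun a =>
      (popularityLaw D (s.erase a) (fun b hb => hD b (Finset.mem_of_mem_erase hb))).map
        (fun l => (a : α) :: l)
  else PMF.pure []
termination_by s.card
decreasing_by exact Finset.card_erase_lt_of_mem a.2

/-- The random list `L` on the probability space `(Ω, P)` is the preference list of a person who
has popularity preferences given by `D` over the set `s` of acceptable partners. -/
def HasPopularityPreferences {Ω α : Type*} [DecidableEq α] [MeasurableSpace Ω] (P : Measure Ω)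
    (L : Ω → List α) (D : α → ℝ) (s : Finset α) (hD : ∀ a ∈ s, 0 < D a) : Prop :=
  ∀ l : List α, MeasurableSet (L ⁻¹' {l}) ∧ P (L ⁻¹' {l}) = popularityLaw D s hD l

/-- The ratio `r_m` between the highest and the lowest popularity given to man `m` by the women
who find him acceptable (woman `w` finds acceptable the men in `A w`, and gives man `m`
popularity `D w m`).  It is `1` if no woman finds `m` acceptable. -/
noncomputable def popularityRatio {M W : Type*} [DecidableEq M] [Fintype W]
    (A : W → Finset M) (D : W → M → ℝ) (m : M) : ℝ :=
  if h : (Finset.univ.filter fun w => m ∈ A w).Nonempty then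
    (Finset.univ.filter fun w => m ∈ A w).sup' h (fun w => D w m) /
      (Finset.univ.filter fun w => m ∈ A w).inf' h (fun w => D w m)
  else 1

/-! Stable matchings yield fixed points of a monotone map on sets of rejected pairs (`rejectStep`),
whose least and greatest fixed points are the men-optimal and women-optimal outcomes. Fix a woman w
and the lists of all other women. Let X be the acceptable men who propose to w when she rejects
everybody, and S y those who propose when she rejects everybody but y; neither depends on her own
list. A stable partner y of w is her favourite in S y (`best_of_holds`), her women-optimal partner b
is her favourite in X (`holds_womenOptimal`), and whether m is her men-optimal partner depends only
on her ordering of S m (`holds_menOptimal_filter`).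

Condition on m. Every other stable partner y lies in X \ S m; there S m ⊆ S y, and the sets S y form
a chain (`suitors_comparable`). That y is her favourite in S y is independent of her ordering of S m
and has probability D y / D(S y) (`listMean_filter_first`). Hence the expected number of stable
partners is at most 1 + log D(X) - log D(S m) (`sum_div_chain_le_log`). The partner b is y ∈ X \ S m
with probability D y / D(X), and m otherwise. The entropy of this law is at most log c if |X \ S m|
+ 1 ≤ c, so the bound becomes 1 + log c + E[log D b] - log D m (`log_sub_log_le_entropy`).

In the sum over women the logarithms regroup by man, because the same men are matched in both
extreme outcomes: each man contributes a difference of logarithms of two popularities given to him,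
at most log r_m, and 0 if the women agree (`sum_heldSum_le`). At most N women are matched, and c may
be d_w or N (`card_suitors_sdiff_lt`). -/

/-! ### Sampling without replacement, as finite weighted sums -/

/-- The probability that sampling without replacement with popularities `D`, from the elements
of the list, yields the list itself. -/
noncomputable def listWeight {α : Type*} (D : α → ℝ) : List α → ℝ
  | [] => 1
  | a :: l => D a / ((a :: l).map D).sum * listWeight D l

/-- The lists that enumerate `A` without repetition. -/
def preferenceLists {α : Type*} [DecidableEq α] (A : Finset α) : Finset (List α) :=
  A.val.lists.toFinset

/-- The mean of `f` over the preference lists sampled without replacement from `A`. -/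
noncomputable def listMean {α : Type*} [DecidableEq α] (D : α → ℝ) (A : Finset α)
    (f : List α → ℝ) : ℝ :=
  ∑ l ∈ preferenceLists A, listWeight D l * f l

theorem mem_preferenceLists {α : Type*} [DecidableEq α] {A : Finset α} {l : List α} :
    l ∈ preferenceLists A ↔ A.val = (l : Multiset α) :=
  Multiset.mem_toFinset.trans (Multiset.mem_lists_iff _ _)

theorem mem_of_mem_preferenceLists {α : Type*} [DecidableEq α] {A : Finset α} {l : List α}
    (h : l ∈ preferenceLists A) {a : α} : a ∈ l ↔ a ∈ A := by
  rw [mem_preferenceLists] at h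
  rw [← Finset.mem_val, h, Multiset.mem_coe]

theorem cons_mem_preferenceLists {α : Type*} [DecidableEq α] {A : Finset α} {a : α} {l : List α} :
    a :: l ∈ preferenceLists A ↔ a ∈ A ∧ l ∈ preferenceLists (A.erase a) := by
  rw [mem_preferenceLists, mem_preferenceLists, Finset.erase_val]
  constructor
  · intro h
    have ha : a ∈ A := by rw [← Finset.mem_val, h]; simp
    refine ⟨ha, ?_⟩
    rw [h]; simp
  · rintro ⟨ha, h⟩
    rw [← Multiset.cons_coe, ← h, Multiset.cons_erase (by simpa using ha)]

theorem sum_preferenceLists {α : Type*} [DecidableEq α] {A : Finset α} (hA : A.Nonempty)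
    (f : List α → ℝ) :
    ∑ l ∈ preferenceLists A, f l = ∑ a ∈ A, ∑ l ∈ preferenceLists (A.erase a), f (a :: l) := by
  rw [Finset.sum_sigma']
  symm
  refine Finset.sum_nbij (fun p => p.1 :: p.2) ?_ ?_ ?_ ?_
  · rintro ⟨a, l⟩ h
    rw [Finset.mem_sigma] at h
    exact cons_mem_preferenceLists.2 h
  · rintro ⟨a, l⟩ _ ⟨b, k⟩ _ h
    simp only [List.cons.injEq] at h
    obtain ⟨rfl, rfl⟩ := h
    rfl
  · intro l hl
    cases l with
    | nil =>
      obtain ⟨a, ha⟩ := hA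
      rw [Finset.mem_coe] at hl
      exact absurd ((mem_of_mem_preferenceLists hl).2 ha) (by simp)
    | cons a l => exact ⟨⟨a, l⟩, by simpa using cons_mem_preferenceLists.1 hl, rfl⟩
  · intros; rfl

theorem listMean_empty {α : Type*} [DecidableEq α] (D : α → ℝ) (f : List α → ℝ) :
    listMean D ∅ f = f [] := by
  have : preferenceLists (∅ : Finset α) = {[]} := by
    ext l; rw [mem_preferenceLists]; simp [eq_comm]
  rw [listMean, this]; simp [listWeight]

theorem sum_map_of_mem_preferenceLists {α : Type*} [DecidableEq α] (D : α → ℝ) {A : Finset α}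
    {l : List α} (h : l ∈ preferenceLists A) : (l.map D).sum = ∑ a ∈ A, D a := by
  rw [mem_preferenceLists] at h
  rw [Finset.sum, h]; simp

/-- Conditioning on the first draw; this recursion drives the inductions on the set of candidates.
-/
theorem listMean_eq_sum {α : Type*} [DecidableEq α] (D : α → ℝ) {A : Finset α}
    (hA : A.Nonempty) (f : List α → ℝ) :
    listMean D A f
      = ∑ a ∈ A, D a / (∑ b ∈ A, D b) * listMean D (A.erase a) (fun l => f (a :: l)) := by
  rw [listMean, sum_preferenceLists hA]
  refine Finset.sum_congr rfl fun a ha => ?_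
  rw [listMean, Finset.mul_sum]
  refine Finset.sum_congr rfl fun l hl => ?_
  rw [listWeight, sum_map_of_mem_preferenceLists D (cons_mem_preferenceLists.2 ⟨ha, hl⟩), mul_assoc]

theorem listMean_congr {α : Type*} [DecidableEq α] (D : α → ℝ) {A : Finset α}
    {f g : List α → ℝ} (h : ∀ l ∈ preferenceLists A, f l = g l) : listMean D A f = listMean D A g :=
  Finset.sum_congr rfl fun l hl => by rw [h l hl]

theorem listMean_mul_left {α : Type*} [DecidableEq α] (D : α → ℝ) (A : Finset α) (c : ℝ)
    (f : List α → ℝ) : listMean D A (fun l => c * f l) = c * listMean D A f := by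
  rw [listMean, listMean, Finset.mul_sum]
  exact Finset.sum_congr rfl fun l _ => by ring

theorem listMean_add {α : Type*} [DecidableEq α] (D : α → ℝ) (A : Finset α)
    (f g : List α → ℝ) :
    listMean D A (fun l => f l + g l) = listMean D A f + listMean D A g := by
  rw [listMean, listMean, listMean, ← Finset.sum_add_distrib]
  exact Finset.sum_congr rfl fun l _ => by ring

theorem listMean_sum {α ι : Type*} [DecidableEq α] (D : α → ℝ) (A : Finset α) (s : Finset ι)
    (f : ι → List α → ℝ) :
    listMean D A (fun l => ∑ i ∈ s, f i l) = ∑ i ∈ s, listMean D A (f i) := by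
  simp only [listMean, Finset.mul_sum]
  exact Finset.sum_comm

theorem listWeight_nonneg {α : Type*} [DecidableEq α] (D : α → ℝ) {l : List α}
    (hD : ∀ a ∈ l, 0 ≤ D a) : 0 ≤ listWeight D l := by
  induction l with
  | nil => simp [listWeight]
  | cons a l ih =>
    refine mul_nonneg (div_nonneg (hD a (by simp)) (List.sum_nonneg ?_))
      (ih fun b hb => hD b (by simp [hb]))
    intro x hx
    obtain ⟨b, hb, rfl⟩ := List.mem_map.1 hx
    exact hD b hb

theorem listWeight_nonneg_of_mem {α : Type*} [DecidableEq α] {D : α → ℝ} {A : Finset α}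
    (hD : ∀ a ∈ A, 0 < D a) {l : List α} (hl : l ∈ preferenceLists A) : 0 ≤ listWeight D l :=
  listWeight_nonneg D fun a ha => (hD a ((mem_of_mem_preferenceLists hl).1 ha)).le

theorem listMean_mono {α : Type*} [DecidableEq α] {D : α → ℝ} {A : Finset α}
    (hD : ∀ a ∈ A, 0 < D a) {f g : List α → ℝ} (h : ∀ l ∈ preferenceLists A, f l ≤ g l) :
    listMean D A f ≤ listMean D A g :=
  Finset.sum_le_sum fun l hl =>
    mul_le_mul_of_nonneg_left (h l hl) (listWeight_nonneg_of_mem hD hl)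

/-- The restriction to `S ⊆ A` of a list sampled from `A` is distributed as a list sampled
from `S`. -/
theorem listMean_filter {α : Type*} [DecidableEq α] {D : α → ℝ} {A S : Finset α}
    (hD : ∀ a ∈ A, 0 < D a) (hS : S ⊆ A) (φ : List α → ℝ) :
    listMean D A (fun l => φ (l.filter (· ∈ S))) = listMean D S φ := by
  induction hn : A.card generalizing A S φ with
  | zero =>
    obtain rfl := Finset.card_eq_zero.1 hn
    obtain rfl := Finset.subset_empty.1 hS
    simp [listMean_empty]
  | succ n ih =>
    have hA : A.Nonempty := Finset.card_pos.1 (by omega)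
    have hpos : 0 < ∑ b ∈ A, D b := Finset.sum_pos hD hA
    have hDe : ∀ a, ∀ b ∈ A.erase a, 0 < D b := fun a b hb => hD b (Finset.mem_of_mem_erase hb)
    have hcard : ∀ a ∈ A, (A.erase a).card = n := fun a ha => by
      rw [Finset.card_erase_of_mem ha, hn]; rfl
    rw [listMean_eq_sum D hA, ← Finset.sum_sdiff hS]
    -- A first draw outside S leaves the restriction unchanged; a first draw inside S becomes its
    -- head, with probabilities still proportional to D.
    have h1 : ∀ a ∈ A \ S, D a / (∑ b ∈ A, D b)
          * listMean D (A.erase a) (fun l => φ ((a :: l).filter (· ∈ S)))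
        = D a / (∑ b ∈ A, D b) * listMean D S φ := by
      intro a ha
      rw [Finset.mem_sdiff] at ha
      rw [← ih (hDe a) (S := S) (fun x hx => Finset.mem_erase.2
        ⟨fun h => ha.2 (h ▸ hx), hS hx⟩) φ (hcard a ha.1)]
      simp [ha.2]
    have h2 : ∀ a ∈ S, D a / (∑ b ∈ A, D b)
          * listMean D (A.erase a) (fun l => φ ((a :: l).filter (· ∈ S)))
        = D a / (∑ b ∈ A, D b) * listMean D (S.erase a) (fun l => φ (a :: l)) := by
      intro a ha
      rw [← ih (hDe a) (S := S.erase a) (Finset.erase_subset_erase a hS) (fun l => φ (a :: l))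
        (hcard a (hS ha))]
      congr 1
      refine listMean_congr D fun l hl => ?_
      rw [List.filter_cons_of_pos (by simpa using ha)]
      congr 2
      refine List.filter_congr fun x hx => ?_
      have : x ≠ a := Finset.ne_of_mem_erase ((mem_of_mem_preferenceLists hl).1 hx)
      simp [this]
    rw [Finset.sum_congr rfl h1, Finset.sum_congr rfl h2, ← Finset.sum_mul, ← Finset.sum_div]
    have h3 : ∑ a ∈ S, D a / (∑ b ∈ A, D b) * listMean D (S.erase a) (fun l => φ (a :: l))
        = (∑ b ∈ S, D b) / (∑ b ∈ A, D b) * listMean D S φ := by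
      rcases S.eq_empty_or_nonempty with rfl | hSn
      · simp
      · have hSpos : 0 < ∑ b ∈ S, D b := Finset.sum_pos (fun b hb => hD b (hS hb)) hSn
        rw [listMean_eq_sum D hSn, Finset.mul_sum]
        refine Finset.sum_congr rfl fun a _ => ?_
        field_simp
    rw [h3, ← add_mul, ← add_div, Finset.sum_sdiff hS, div_self hpos.ne', one_mul]

theorem listMean_const {α : Type*} [DecidableEq α] {D : α → ℝ} {A : Finset α}
    (hD : ∀ a ∈ A, 0 < D a) (c : ℝ) : listMean D A (fun _ => c) = c := by
  rw [listMean_filter hD (Finset.empty_subset A) (fun _ => c), listMean_empty]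

/-- For `y ∈ Q \ S` with `S ⊆ Q ⊆ A`, the event that `y` is the favourite element of `Q` is
independent of the relative order of the elements of `S`, and has probability
`D y / ∑ b ∈ Q, D b`. -/
theorem listMean_filter_first {α : Type*} [DecidableEq α] {D : α → ℝ} {A Q S : Finset α}
    (hD : ∀ a ∈ A, 0 < D a) (hQ : Q ⊆ A) (hS : S ⊆ Q) {y : α} (hy : y ∈ Q) (hyS : y ∉ S)
    (φ : List α → ℝ) :
    listMean D A (fun l => if ∀ x ∈ Q, ¬ l.idxOf x < l.idxOf y then φ (l.filter (· ∈ S)) else 0)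
      = D y / (∑ b ∈ Q, D b) * listMean D A (fun l => φ (l.filter (· ∈ S))) := by
  rw [listMean_filter hD (hS.trans hQ)]
  induction hn : A.card generalizing A with
  | zero =>
    obtain rfl := Finset.card_eq_zero.1 hn
    exact absurd (hQ hy) (by simp)
  | succ n ih =>
    have hA : A.Nonempty := ⟨y, hQ hy⟩
    have hpos : 0 < ∑ b ∈ A, D b := Finset.sum_pos hD hA
    have hQpos : 0 < ∑ b ∈ Q, D b := Finset.sum_pos (fun b hb => hD b (hQ hb)) ⟨y, hy⟩
    have hDe : ∀ a, ∀ b ∈ A.erase a, 0 < D b := fun a b hb => hD b (Finset.mem_of_mem_erase hb)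
    rw [listMean_eq_sum D hA, ← Finset.sum_sdiff hQ]
    -- A first draw outside Q postpones the event, while one inside Q decides it: the event holds
    -- exactly when y is drawn.
    have h1 : ∀ a ∈ A \ Q, D a / (∑ b ∈ A, D b) * listMean D (A.erase a) (fun l =>
          if ∀ x ∈ Q, ¬ (a :: l).idxOf x < (a :: l).idxOf y
          then φ ((a :: l).filter (· ∈ S)) else 0)
        = D a / (∑ b ∈ A, D b) * (D y / (∑ b ∈ Q, D b) * listMean D S φ) := by
      intro a ha
      rw [Finset.mem_sdiff] at ha
      rw [← ih (hDe a) (fun x hx => Finset.mem_erase.2 ⟨fun h => ha.2 (h ▸ hx), hQ hx⟩)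
        (by rw [Finset.card_erase_of_mem ha.1, hn]; rfl)]
      congr 1
      refine listMean_congr D fun l _ => ?_
      have hx : ∀ x ∈ Q, (a :: l).idxOf x = l.idxOf x + 1 := fun x hx =>
        List.idxOf_cons_ne l (fun h => ha.2 (h ▸ hx))
      have hiff : (∀ x ∈ Q, ¬ (a :: l).idxOf x < (a :: l).idxOf y)
          ↔ ∀ x ∈ Q, ¬ l.idxOf x < l.idxOf y :=
        forall₂_congr fun x hxQ => by rw [hx x hxQ, hx y hy]; omega
      have haS : a ∉ S := fun h => ha.2 (hS h)
      simp only [hiff]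
      rw [List.filter_cons_of_neg (by simpa using haS)]
    have h2 : ∀ a ∈ Q, D a / (∑ b ∈ A, D b) * listMean D (A.erase a) (fun l =>
          if ∀ x ∈ Q, ¬ (a :: l).idxOf x < (a :: l).idxOf y
          then φ ((a :: l).filter (· ∈ S)) else 0)
        = if a = y then D y / (∑ b ∈ A, D b) * listMean D S φ else 0 := by
      intro a ha
      split_ifs with h
      · subst h
        congr 1
        rw [← listMean_filter (hDe a) (S := S) (fun x hx => Finset.mem_erase.2
          ⟨fun h => hyS (h ▸ hx), hQ (hS hx)⟩) φ]
        refine listMean_congr D fun l _ => ?_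
        rw [if_pos (by simp), List.filter_cons_of_neg (by simpa using hyS)]
      · have : listMean D (A.erase a) (fun l =>
          if ∀ x ∈ Q, ¬ (a :: l).idxOf x < (a :: l).idxOf y
          then φ ((a :: l).filter (· ∈ S)) else 0) = listMean D (A.erase a) (fun _ => 0) := by
          refine listMean_congr D fun l _ => ?_
          rw [if_neg]
          intro hc
          refine hc a ha ?_
          rw [List.idxOf_cons_self, List.idxOf_cons_ne l h]
          omega
        rw [this, listMean_const (hDe a), mul_zero]
    rw [Finset.sum_congr rfl h1, Finset.sum_congr rfl h2, ← Finset.sum_mul, ← Finset.sum_div,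
      Finset.sum_ite_eq' Q y, if_pos hy]
    -- It remains that p = D y / D(Q) solves p = (D(A) - D(Q)) / D(A) * p + D y / D(A).
    have h3 : ∑ b ∈ A \ Q, D b = ∑ b ∈ A, D b - ∑ b ∈ Q, D b := by
      rw [← Finset.sum_sdiff hQ]; ring
    rw [h3]
    field_simp
    ring

/-! ### Two logarithmic inequalities -/

/-- For sets `T y ∋ y` that form a chain and contain `S`, the sum of the shares of `y` in `T y`
is at most the logarithm of the growth of the total popularity. -/
theorem sum_div_chain_le_log {α : Type*} [DecidableEq α] {D : α → ℝ} {S U : Finset α}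
    (T : α → Finset α) (hS : S.Nonempty) 
    (hDT : ∀ y ∈ U, ∀ a ∈ T y, 0 < D a) (hSU : Disjoint S U)
    (hST : ∀ y ∈ U, S ⊆ T y) (hy : ∀ y ∈ U, y ∈ T y)
    (hT : ∀ y ∈ U, ∀ z ∈ U, T y ⊆ T z ∨ T z ⊆ T y) :
    ∑ y ∈ U, D y / ∑ b ∈ T y, D b
      ≤ Real.log (∑ b ∈ S ∪ U, D b) - Real.log (∑ b ∈ S, D b) := by
  induction hn : U.card generalizing U with
  | zero =>
    obtain rfl := Finset.card_eq_zero.1 hn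
    simp
  | succ n ih =>
    have hU : U.Nonempty := Finset.card_pos.1 (by omega)
    -- The largest set of the chain contains every `T z`, hence every z ∈ U, hence all of S ∪ U; its
    -- y is removed first.
    obtain ⟨y, hyU, hmax⟩ := Finset.exists_max_image U (fun y => (T y).card) hU
    have hsub : ∀ z ∈ U, T z ⊆ T y := by
      intro z hz
      rcases hT y hyU z hz with h | h
      · rw [Finset.eq_of_subset_of_card_le h (hmax z hz)]
      · exact h
    have hSUT : S ∪ U ⊆ T y := Finset.union_subset (hST y hyU) fun z hz => hsub z hz (hy z hz)
    have hD : ∀ a ∈ S ∪ U, 0 < D a := fun a ha => hDT y hyU a (hSUT ha)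
    have herase : ∀ z ∈ U.erase y, z ∈ U := fun z hz => Finset.mem_of_mem_erase hz
    have hih := ih (U := U.erase y) (fun z hz => hDT z (herase z hz))
      (hSU.mono_right (Finset.erase_subset _ _)) (fun z hz => hST z (herase z hz))
      (fun z hz => hy z (herase z hz))
      (fun z hz t ht => hT z (herase z hz) t (herase t ht))
      (by rw [Finset.card_erase_of_mem hyU, hn]; rfl)
    rw [← Finset.add_sum_erase _ _ hyU]
    have hyS : y ∉ S := Finset.disjoint_right.1 hSU hyU
    have hsum : ∑ b ∈ S ∪ U, D b = D y + ∑ b ∈ S ∪ U.erase y, D b := by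
      rw [← Finset.add_sum_erase _ _ (Finset.mem_union_right S hyU), Finset.erase_union_distrib,
        Finset.erase_eq_of_notMem hyS]
    have hpos : 0 < ∑ b ∈ S ∪ U.erase y, D b :=
      Finset.sum_pos (fun a ha => hD a (Finset.union_subset_union_right
        (Finset.erase_subset _ _) ha)) (hS.mono Finset.subset_union_left)
    have hDy : 0 < D y := hD y (Finset.mem_union_right S hyU)
    have h1 : D y / ∑ b ∈ T y, D b ≤ D y / ∑ b ∈ S ∪ U, D b := by
      refine div_le_div_of_nonneg_left hDy.le (by rw [hsum]; positivity) ?_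
      exact Finset.sum_le_sum_of_subset_of_nonneg hSUT fun a ha _ => (hDT y hyU a ha).le
    have h2 : D y / ∑ b ∈ S ∪ U, D b
        ≤ Real.log (∑ b ∈ S ∪ U, D b) - Real.log (∑ b ∈ S ∪ U.erase y, D b) := by
      rw [hsum]
      set t := ∑ b ∈ S ∪ U.erase y, D b
      have h := Real.log_le_sub_one_of_pos (x := t / (D y + t)) (by positivity)
      rw [Real.log_div hpos.ne' (by positivity)] at h
      have : t / (D y + t) - 1 = - (D y / (D y + t)) := by field_simp; ring
      linarith
    linarith

/-- A form of the fact that the entropy of a law on at most `c` points is at most `log c`. -/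
theorem log_sub_log_le_entropy {α : Type*} {D : α → ℝ} {U : Finset α} {d s c : ℝ}
    (hD : ∀ a ∈ U, 0 < D a) (hd : 0 < d) (hs : d ≤ s) (hc : (U.card : ℝ) + 1 ≤ c) :
    Real.log (s + ∑ b ∈ U, D b) - Real.log s
      ≤ Real.log c + ∑ y ∈ U, D y / (s + ∑ b ∈ U, D b) * Real.log (D y)
        + s / (s + ∑ b ∈ U, D b) * Real.log d - Real.log d := by
  have hs0 : 0 < s := hd.trans_le hs
  have hU : 0 ≤ ∑ b ∈ U, D b := Finset.sum_nonneg fun a ha => (hD a ha).le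
  have hsum : ∑ b ∈ U, D b = (s + ∑ b ∈ U, D b) - s := by ring
  set T := s + ∑ b ∈ U, D b
  have hT : 0 < T := by positivity
  have hc0 : 0 < c := by have : (0 : ℝ) ≤ U.card := Nat.cast_nonneg _
                         linarith
  -- One term of Gibbs' inequality against the weight 1/c; at most c such terms are added.
  have key : ∀ x, 0 < x → x / T * (Real.log T - Real.log x - Real.log c) ≤ 1 / c - x / T := by
    intro x hx
    have h := Real.log_le_sub_one_of_pos (x := T / x / c) (by positivity)
    rw [Real.log_div (by positivity) hc0.ne', Real.log_div hT.ne' hx.ne'] at h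
    calc _ ≤ x / T * (T / x / c - 1) := mul_le_mul_of_nonneg_left h (by positivity)
      _ = _ := by field_simp
  have h1 : ∑ y ∈ U, D y / T * (Real.log T - Real.log (D y) - Real.log c)
      ≤ ∑ y ∈ U, (1 / c - D y / T) := Finset.sum_le_sum fun y hy => key _ (hD y hy)
  have h2 := key s hs0
  have h3 : ∑ y ∈ U, (1 / c - D y / T) = U.card / c - (T - s) / T := by
    rw [Finset.sum_sub_distrib, ← Finset.sum_div _ _ T, hsum, Finset.sum_const, nsmul_eq_mul]; ring
  have h4 : ∑ y ∈ U, D y / T * (Real.log T - Real.log (D y) - Real.log c)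
      = (T - s) / T * (Real.log T - Real.log c) - ∑ y ∈ U, D y / T * Real.log (D y) := by
    rw [← hsum, Finset.sum_div, Finset.sum_mul, ← Finset.sum_sub_distrib]
    exact Finset.sum_congr rfl fun y _ => by ring
  have h5 : (T - s) / T = 1 - s / T := by field_simp
  have h6 : ((U.card : ℝ) + 1) / c ≤ 1 := (div_le_one hc0).2 hc
  have h7 : ((U.card : ℝ) + 1) / c = U.card / c + 1 / c := by ring
  have h8 : s / T ≤ 1 := (div_le_one hT).2 (by linarith)
  have h9 : Real.log d ≤ Real.log s := Real.log_le_log hd hs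
  -- The term log s carries the total coefficient -(1 - s/T) ≤ 0, so it may be replaced by the
  -- smaller log d.
  have h10 : 0 ≤ (1 - s / T) * (Real.log s - Real.log d) :=
    mul_nonneg (by linarith) (by linarith)
  rw [h3, h4, h5] at h1
  nlinarith

/-! ### Deferred acceptance as a monotone map on rejected pairs -/

/-- When the pairs in `F` have been rejected, man `m` has proposed to the acceptable woman `w`
if all the women he prefers to `w` have rejected him. -/
def Proposes {M W : Type*} [DecidableEq W] (menPref : M → List W) (F : Set (M × W)) (m : M)
    (w : W) : Prop :=
  w ∈ menPref m ∧ ∀ v, (menPref m).idxOf v < (menPref m).idxOf w → (m, v) ∈ F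

/-- When the pairs in `F` have been rejected, woman `w` holds the proposal of man `m`. -/
def Holds {M W : Type*} [DecidableEq W] (menPref : M → List W) (F : Set (M × W)) (m : M)
    (w : W) : Prop :=
  Proposes menPref F m w ∧ (m, w) ∉ F

/-- A woman with preference list `l` rejects a proposal if it is unacceptable or if she received
a better one. -/
def rejectList {M : Type*} [DecidableEq M] (l : List M) : Set M →o Set M where
  toFun S := {m | m ∈ S ∧ (m ∉ l ∨ ∃ x ∈ S, l.idxOf x < l.idxOf m)}
  monotone' := by
    rintro S T h m ⟨hm, hl | ⟨x, hx, hlt⟩⟩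
    · exact ⟨h hm, Or.inl hl⟩
    · exact ⟨h hm, Or.inr ⟨x, h hx, hlt⟩⟩

/-- The behaviour of a woman who rejects exactly the men in `R`. -/
def rejectSet {M : Type*} (R : Set M) : Set M →o Set M where
  toFun S := S ∩ R
  monotone' := fun _ _ h => Set.inter_subset_inter_left _ h

/-- One round of deferred acceptance, where `ρ` describes which proposals the women reject. -/
def rejectStep {M W : Type*} [DecidableEq W] (menPref : M → List W)
    (ρ : W → Set M →o Set M) : Set (M × W) →o Set (M × W) where
  toFun F := {p | p.1 ∈ ρ p.2 {m | Proposes menPref F m p.2}}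
  monotone' := by
    intro F F' h p hp
    have hsub : {m | Proposes menPref F m p.2} ⊆ {m | Proposes menPref F' m p.2} :=
      fun m hm => ⟨hm.1, fun v hv => h (hm.2 v hv)⟩
    exact (ρ p.2).monotone hsub hp

section

variable {M W : Type*} [DecidableEq W] {menPref : M → List W}

theorem Proposes.mono {F F' : Set (M × W)} (h : F ⊆ F') {m : M} {w : W}
    (hp : Proposes menPref F m w) : Proposes menPref F' m w :=
  ⟨hp.1, fun v hv => h (hp.2 v hv)⟩

theorem mem_rejectStep {ρ : W → Set M →o Set M} {F : Set (M × W)} {m : M} {w : W} :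
    (m, w) ∈ rejectStep menPref ρ F ↔ m ∈ ρ w {x | Proposes menPref F x w} := Iff.rfl

theorem mem_rejectList [DecidableEq M] {l : List M} {S : Set M} {m : M} :
    m ∈ rejectList l S ↔ m ∈ S ∧ (m ∉ l ∨ ∃ x ∈ S, l.idxOf x < l.idxOf m) := Iff.rfl

/-- Two behaviours that reject the same men among those who propose have the same fixed
points. -/
theorem rejectStep_eq_of_congr {ρ ρ' : W → Set M →o Set M} {F : Set (M × W)}
    (hF : rejectStep menPref ρ F = F)
    (h : ∀ w, ρ' w {x | Proposes menPref F x w} = ρ w {x | Proposes menPref F x w}) :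
    rejectStep menPref ρ' F = F := by
  rw [← hF]
  conv_lhs => rw [hF]
  ext ⟨m, w⟩
  rw [mem_rejectStep, mem_rejectStep, h]

theorem Holds.unique_right {F : Set (M × W)} {m : M} {v w : W} (hv : Holds menPref F m v)
    (hw : Holds menPref F m w) : v = w := by
  rcases lt_trichotomy ((menPref m).idxOf v) ((menPref m).idxOf w) with h | h | h
  · exact absurd (hw.1.2 v h) hv.2
  · exact (List.idxOf_inj hv.1.1).1 h
  · exact absurd (hv.1.2 w h) hw.2

/-- A man who is not held by any woman has been rejected by all acceptable women. -/
theorem mem_of_not_holds {F : Set (M × W)} {m : M} (h : ∀ v, ¬ Holds menPref F m v) {w : W}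
    (hw : w ∈ menPref m) : (m, w) ∈ F := by
  induction hn : (menPref m).idxOf w using Nat.strong_induction_on generalizing w with
  | _ n ih =>
    by_contra hF
    refine h w ⟨⟨hw, fun v hv => ?_⟩, hF⟩
    -- An unlisted element has the length of the list as its index, so whatever precedes a listed
    -- element is listed.
    have hvm : v ∈ menPref m :=
      List.idxOf_lt_length_iff.1 (hv.trans (List.idxOf_lt_length_of_mem hw))
    exact ih _ (hn ▸ hv) hvm rfl

/-- A woman with a preference list holds at most one man, her favourite one among those who
proposed. -/
theorem Holds.best [DecidableEq M] {ρ : W → Set M →o Set M} {F : Set (M × W)}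
    (hF : rejectStep menPref ρ F = F) {w : W} {l : List M} (hw : ρ w = rejectList l) {m : M}
    (hm : Holds menPref F m w) :
    m ∈ l ∧ ∀ x, Proposes menPref F x w → ¬ l.idxOf x < l.idxOf m := by
  have h := hm.2
  rw [← hF, mem_rejectStep, hw, mem_rejectList, not_and, not_or, not_not] at h
  obtain ⟨h1, h2⟩ := h hm.1
  exact ⟨h1, fun x hx hlt => h2 ⟨x, hx, hlt⟩⟩

theorem holds_of_best [DecidableEq M] {ρ : W → Set M →o Set M} {F : Set (M × W)}
    (hF : rejectStep menPref ρ F = F) {w : W} {l : List M} (hw : ρ w = rejectList l) {m : M}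
    (hm : Proposes menPref F m w) (hl : m ∈ l)
    (hbest : ∀ x, Proposes menPref F x w → ¬ l.idxOf x < l.idxOf m) : Holds menPref F m w := by
  refine ⟨hm, ?_⟩
  rw [← hF, mem_rejectStep, hw, mem_rejectList]
  rintro ⟨_, h | ⟨x, hx, hlt⟩⟩
  · exact h hl
  · exact hbest x hx hlt

theorem Holds.unique_left [DecidableEq M] {ρ : W → Set M →o Set M} {F : Set (M × W)}
    (hF : rejectStep menPref ρ F = F) {w : W} {l : List M} (hw : ρ w = rejectList l) {m m' : M}
    (hm : Holds menPref F m w) (hm' : Holds menPref F m' w) : m = m' := by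
  obtain ⟨h1, h2⟩ := hm.best hF hw
  obtain ⟨-, h3⟩ := hm'.best hF hw
  exact (List.idxOf_inj h1).1 (le_antisymm (not_lt.1 (h2 m' hm'.1)) (not_lt.1 (h3 m hm.1)))

theorem exists_best [DecidableEq M] {l : List M} {S : Set M} {m : M} (hm : m ∈ S) (hl : m ∈ l) :
    ∃ b ∈ S, b ∈ l ∧ ∀ x ∈ S, ¬ l.idxOf x < l.idxOf b := by
  obtain ⟨b, hb, hmin⟩ := (measure fun x => l.idxOf x).wf.has_min S ⟨m, hm⟩
  refine ⟨b, hb, ?_, hmin⟩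
  have h : ¬ l.idxOf m < l.idxOf b := hmin m hm
  exact List.idxOf_lt_length_iff.1 ((not_lt.1 h).trans_lt (List.idxOf_lt_length_of_mem hl))

theorem exists_holds [DecidableEq M] {ρ : W → Set M →o Set M} {F : Set (M × W)}
    (hF : rejectStep menPref ρ F = F) {w : W} {l : List M} (hw : ρ w = rejectList l) {m : M}
    (hm : Proposes menPref F m w) (hl : m ∈ l) : ∃ x, Holds menPref F x w := by
  obtain ⟨b, hb, hbl, hmin⟩ := exists_best (S := {x | Proposes menPref F x w}) hm hl
  exact ⟨b, holds_of_best hF hw hb hbl hmin⟩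

/-- If more pairs are rejected then fewer men are held. -/
theorem exists_holds_of_subset {F F' : Set (M × W)} (h : F ⊆ F') {m : M}
    (hm : ∃ v, Holds menPref F' m v) : ∃ v, Holds menPref F m v := by
  by_contra hc
  obtain ⟨v, hv⟩ := hm
  exact hv.2 (h (mem_of_not_holds (not_exists.1 hc) hv.1.1))

-- Exact without any fixed-point condition: a man is held by at most one woman, the first on his
-- list who has not rejected him.
open scoped Classical in
theorem card_exists_holds [Fintype M] [Fintype W] (F : Set (M × W)) :
    (Finset.univ.filter fun m => ∃ v, Holds menPref F m v).card
      = ∑ v, (Finset.univ.filter fun m => Holds menPref F m v).card := by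
  rw [← Finset.card_biUnion]
  · congr 1
    ext m; simp
  · intro v _ w _ hvw
    rw [Function.onFun, Finset.disjoint_left]
    intro m hv hw
    exact hvw (((Finset.mem_filter.1 hv).2).unique_right (Finset.mem_filter.1 hw).2)

open scoped Classical in
theorem card_holds_le_one [DecidableEq M] [Fintype M] {ρ : W → Set M →o Set M} {F : Set (M × W)}
    (hF : rejectStep menPref ρ F = F) {w : W} {l : List M} (hw : ρ w = rejectList l) :
    (Finset.univ.filter fun m => Holds menPref F m w).card ≤ 1 :=
  Finset.card_le_one.2 fun _ ha _ hb =>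
    (Finset.mem_filter.1 ha).2.unique_left hF hw (Finset.mem_filter.1 hb).2

-- More rejections bring more proposals, and a woman who follows a list holds somebody as soon as an
-- acceptable man has proposed.
open scoped Classical in
theorem card_holds_le_of_subset [DecidableEq M] [Fintype M]
    {ρ ρ' : W → Set M →o Set M} {F F' : Set (M × W)}
    (hF : rejectStep menPref ρ F = F) (hF' : rejectStep menPref ρ' F' = F') (h : F ⊆ F')
    {w : W} {l : List M} (hw : ρ w = rejectList l) (hw' : ρ' w = rejectList l) :
    (Finset.univ.filter fun m => Holds menPref F m w).card
      ≤ (Finset.univ.filter fun m => Holds menPref F' m w).card := by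
  rcases (Finset.univ.filter fun m => Holds menPref F m w).eq_empty_or_nonempty with h0 | ⟨m, hm⟩
  · rw [h0]; simp
  · have hm := (Finset.mem_filter.1 hm).2
    obtain ⟨x, hx⟩ := exists_holds hF' hw' (hm.1.mono h) (hm.best hF hw).1
    exact (card_holds_le_one hF hw).trans
      (Finset.card_pos.2 ⟨x, Finset.mem_filter.2 ⟨Finset.mem_univ _, hx⟩⟩)

open scoped Classical in
/-- If more pairs are rejected, and all women but `w` follow the same preference lists, then `w`
holds fewer men. -/
theorem card_holds_le_of_subset_of_forall_ne [DecidableEq M] [Fintype M] [Fintype W]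
    {ρ ρ' : W → Set M →o Set M}
    {F F' : Set (M × W)} (hF : rejectStep menPref ρ F = F) (hF' : rejectStep menPref ρ' F' = F')
    (h : F ⊆ F') {w : W} (l : W → List M) (hw : ∀ v ≠ w, ρ v = rejectList (l v))
    (hw' : ∀ v ≠ w, ρ' v = rejectList (l v)) :
    (Finset.univ.filter fun m => Holds menPref F' m w).card
      ≤ (Finset.univ.filter fun m => Holds menPref F m w).card := by
  -- The total number of held men can only drop while every other woman's count can only grow, so
  -- the count of w must drop.
  have h1 : (Finset.univ.filter fun m => ∃ v, Holds menPref F' m v).card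
      ≤ (Finset.univ.filter fun m => ∃ v, Holds menPref F m v).card :=
    Finset.card_le_card fun m hm => by
      rw [Finset.mem_filter] at hm ⊢
      exact ⟨hm.1, exists_holds_of_subset h hm.2⟩
  rw [card_exists_holds, card_exists_holds, ← Finset.add_sum_erase _ _ (Finset.mem_univ w),
    ← Finset.add_sum_erase _ _ (Finset.mem_univ w)] at h1
  have h2 : ∑ v ∈ Finset.univ.erase w, (Finset.univ.filter fun m => Holds menPref F m v).card
      ≤ ∑ v ∈ Finset.univ.erase w, (Finset.univ.filter fun m => Holds menPref F' m v).card :=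
    Finset.sum_le_sum fun v hv => by
      have hv := Finset.ne_of_mem_erase hv
      exact card_holds_le_of_subset hF hF' h (hw v hv) (hw' v hv)
  omega

/-- The same men are held in comparable stable matchings. -/
theorem exists_holds_iff_of_subset [DecidableEq M] [Fintype M] [Fintype W] {ρ : W → Set M →o Set M}
    {F F' : Set (M × W)} (hF : rejectStep menPref ρ F = F) (hF' : rejectStep menPref ρ F' = F')
    (h : F ⊆ F') (l : W → List M) (hρ : ∀ v, ρ v = rejectList (l v)) (m : M) :
    (∃ v, Holds menPref F m v) ↔ ∃ v, Holds menPref F' m v := by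
  classical
  refine ⟨fun hm => ?_, exists_holds_of_subset h⟩
  have hsub : (Finset.univ.filter fun m => ∃ v, Holds menPref F' m v)
      ⊆ Finset.univ.filter fun m => ∃ v, Holds menPref F m v := fun m hm => by
    rw [Finset.mem_filter] at hm ⊢
    exact ⟨hm.1, exists_holds_of_subset h hm.2⟩
  have heq := Finset.eq_of_subset_of_card_le hsub (by
    rw [card_exists_holds, card_exists_holds]
    exact Finset.sum_le_sum fun v _ => card_holds_le_of_subset hF hF' h (hρ v) (hρ v))
  have : m ∈ Finset.univ.filter fun m => ∃ v, Holds menPref F' m v := by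
    rw [heq]; simpa using hm
  simpa using this

/-- A man descends his list down to his partner, or to its end if he is single; the hypothesis
guarantees that a partner is on the list. -/
theorem proposes_iff_of_stable {μ : M ≃. W} (hμ : ∀ m, ¬ Prefers (menPref m) none (μ m))
    {m : M} {v : W} :
    Proposes menPref {p | Prefers (menPref p.1) (some p.2) (μ p.1)} m v
      ↔ Prefers (menPref m) (some v) (μ m) ∨ μ m = some v := by
  have hm := hμ m
  unfold Proposes
  simp only [Set.mem_ofPred_eq]
  cases hmu : μ m with
  | none =>
    simp only [Prefers, reduceCtorEq, or_false, and_iff_left_iff_imp]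
    intro hv u hu
    exact List.idxOf_lt_length_iff.1 (hu.trans (List.idxOf_lt_length_of_mem hv))
  | some u =>
    rw [hmu] at hm
    simp only [Prefers, not_not] at hm
    simp only [Prefers, Option.some.injEq]
    constructor
    · rintro ⟨hv, h⟩
      rcases lt_trichotomy ((menPref m).idxOf v) ((menPref m).idxOf u) with h' | h' | h'
      · exact Or.inl h'
      · exact Or.inr ((List.idxOf_inj hv).1 h').symm
      · exact absurd (h u h') (lt_irrefl _)
    · rintro (h | rfl)
      · exact ⟨List.idxOf_lt_length_iff.1 (h.trans (List.idxOf_lt_length_of_mem hm)),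
          fun w hw => hw.trans h⟩
      · exact ⟨hm, fun w hw => hw⟩

/-- A stable matching gives a fixed point of deferred acceptance. -/
theorem exists_fixedPoint_of_mem_stablePairs [DecidableEq M] {womenPref : W → List M} {p : M × W}
    (hp : p ∈ stablePairs menPref womenPref) :
    ∃ F, rejectStep menPref (fun w => rejectList (womenPref w)) F = F ∧
      Holds menPref F p.1 p.2 := by
  obtain ⟨μ, ⟨h1, h2, h3⟩, hpμ⟩ := hp
  have hirr : ∀ m v, μ m = some v → ¬ Prefers (menPref m) (some v) (μ m) := fun m v h => by
    rw [h]; exact lt_irrefl _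
  -- A pair counts as rejected when the man would prefer the woman to his situation in the matching.
  refine ⟨{p | Prefers (menPref p.1) (some p.2) (μ p.1)}, ?_, ?_, hirr _ _ hpμ⟩
  · ext ⟨m, v⟩
    rw [mem_rejectStep, mem_rejectList]
    simp only [Set.mem_ofPred_eq, proposes_iff_of_stable h1]
    constructor
    · rintro ⟨h | h, hr⟩
      · exact h
      · have hs : μ.symm v = some m := (PEquiv.mem_iff_mem μ).2 h
        have h2v := h2 v
        rw [hs] at h2v
        simp only [Prefers, not_not] at h2v
        rcases hr with hr | ⟨x, hx | hx, hlt⟩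
        · exact absurd h2v hr
        · refine absurd ⟨?_, hx⟩ (h3 x v)
          rw [hs]; exact hlt
        · have : x = m := PEquiv.inj μ hx h
          rw [this] at hlt
          exact absurd hlt (lt_irrefl _)
    · intro h
      refine ⟨Or.inl h, ?_⟩
      have h3v : ¬ Prefers (womenPref v) (some m) (μ.symm v) := fun hc => h3 m v ⟨hc, h⟩
      cases hs : μ.symm v with
      | none =>
        rw [hs] at h3v
        exact Or.inl h3v
      | some x =>
        have h2v := h2 v
        rw [hs] at h2v h3v
        simp only [Prefers, not_not] at h2v h3v
        have hx : μ x = some v := (PEquiv.mem_iff_mem μ).1 hs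
        refine Or.inr ⟨x, Or.inr hx, lt_of_le_of_ne (not_lt.1 h3v) fun heq => ?_⟩
        have : x = m := (List.idxOf_inj h2v).1 heq
        subst this
        exact hirr _ _ hx h
  · exact (proposes_iff_of_stable h1).2 (Or.inr hpμ)

end

/-! ### The suitors of one woman under a prescribed set of rejections -/

/-- All women but `w` follow the preference lists `ℓ`, and `w` rejects exactly the men in `R`. -/
def rejectAt {M W : Type*} [DecidableEq M] [DecidableEq W] (ℓ : W → List M) (w : W) (R : Set M) :
    W → Set M →o Set M :=
  Function.update (fun v => rejectList (ℓ v)) w (rejectSet R)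

/-- The pairs rejected in deferred acceptance when all women but `w` follow the preference
lists `ℓ`, and `w` rejects exactly the men in `R`. -/
def rejections {M W : Type*} [DecidableEq M] [DecidableEq W] (menPref : M → List W)
    (ℓ : W → List M) (w : W) (R : Set M) : Set (M × W) :=
  (rejectStep menPref (rejectAt ℓ w R)).lfp

/-- The men who propose to `w` when she rejects exactly the men in `R`. -/
def suitors {M W : Type*} [DecidableEq M] [DecidableEq W] (menPref : M → List W)
    (ℓ : W → List M) (w : W) (R : Set M) : Set M :=
  {m | Proposes menPref (rejections menPref ℓ w R) m w}

/-- The set of pairs rejected in the stable matching that is best for the men. -/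
def menOptimal {M W : Type*} [DecidableEq M] [DecidableEq W] (menPref : M → List W)
    (ℓ : W → List M) : Set (M × W) :=
  (rejectStep menPref fun v => rejectList (ℓ v)).lfp

/-- The set of pairs rejected in the stable matching that is best for the women. -/
def womenOptimal {M W : Type*} [DecidableEq M] [DecidableEq W] (menPref : M → List W)
    (ℓ : W → List M) : Set (M × W) :=
  (rejectStep menPref fun v => rejectList (ℓ v)).gfp

theorem mem_rejectSet {M : Type*} {R S : Set M} {m : M} :
    m ∈ rejectSet R S ↔ m ∈ S ∧ m ∈ R := Iff.rfl

section

variable {M W : Type*} [DecidableEq M] [DecidableEq W] {menPref : M → List W}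
  {ℓ : W → List M} {w : W}

theorem rejectAt_self (R : Set M) : rejectAt ℓ w R w = rejectSet R := by simp [rejectAt]

theorem rejectAt_of_ne (R : Set M) {v : W} (h : v ≠ w) :
    rejectAt ℓ w R v = rejectList (ℓ v) := by simp [rejectAt, h]

theorem rejectAt_update (l : List M) (R : Set M) :
    rejectAt (Function.update ℓ w l) w R = rejectAt ℓ w R := by
  funext v
  by_cases h : v = w
  · subst h; rw [rejectAt_self, rejectAt_self]
  · rw [rejectAt_of_ne R h, rejectAt_of_ne R h, Function.update_of_ne h]

theorem rejections_update (l : List M) (R : Set M) :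
    rejections menPref (Function.update ℓ w l) w R = rejections menPref ℓ w R := by
  rw [rejections, rejectAt_update, rejections]

/-- This makes the sets of suitors deterministic once the lists of the other women are fixed. -/
theorem suitors_update (l : List M) (R : Set M) :
    suitors menPref (Function.update ℓ w l) w R = suitors menPref ℓ w R := by
  rw [suitors, rejections_update, suitors]

theorem rejectStep_rejections (R : Set M) :
    rejectStep menPref (rejectAt ℓ w R) (rejections menPref ℓ w R) = rejections menPref ℓ w R :=
  OrderHom.map_lfp _

theorem rejections_subset {R : Set M} {F : Set (M × W)}
    (h : rejectStep menPref (rejectAt ℓ w R) F = F) : rejections menPref ℓ w R ⊆ F :=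
  OrderHom.lfp_le_fixed _ h

theorem rejectStep_menOptimal :
    rejectStep menPref (fun v => rejectList (ℓ v)) (menOptimal menPref ℓ)
      = menOptimal menPref ℓ := OrderHom.map_lfp _

theorem menOptimal_subset {F : Set (M × W)}
    (h : rejectStep menPref (fun v => rejectList (ℓ v)) F = F) : menOptimal menPref ℓ ⊆ F :=
  OrderHom.lfp_le_fixed _ h

theorem rejectStep_womenOptimal :
    rejectStep menPref (fun v => rejectList (ℓ v)) (womenOptimal menPref ℓ)
      = womenOptimal menPref ℓ := OrderHom.map_gfp _

theorem subset_womenOptimal {F : Set (M × W)}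
    (h : rejectStep menPref (fun v => rejectList (ℓ v)) F = F) : F ⊆ womenOptimal menPref ℓ :=
  OrderHom.le_gfp _ h.ge

theorem menOptimal_subset_womenOptimal : menOptimal menPref ℓ ⊆ womenOptimal menPref ℓ :=
  menOptimal_subset rejectStep_womenOptimal

theorem rejections_mono {R R' : Set M} (h : R ⊆ R') :
    rejections menPref ℓ w R ⊆ rejections menPref ℓ w R' := by
  refine OrderHom.lfp_le _ ?_
  conv_rhs => rw [← rejectStep_rejections]
  rintro ⟨m, v⟩ hm
  rw [mem_rejectStep] at hm ⊢
  by_cases hv : v = w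
  · subst hv
    rw [rejectAt_self, mem_rejectSet] at hm ⊢
    exact ⟨hm.1, h hm.2⟩
  · rw [rejectAt_of_ne _ hv] at hm ⊢
    exact hm

theorem suitors_mono_of_subset {R R' : Set M}
    (h : rejections menPref ℓ w R ⊆ rejections menPref ℓ w R') :
    suitors menPref ℓ w R ⊆ suitors menPref ℓ w R' := fun _ hm => Proposes.mono h hm

theorem suitors_mono {R R' : Set M} (h : R ⊆ R') :
    suitors menPref ℓ w R ⊆ suitors menPref ℓ w R' := suitors_mono_of_subset (rejections_mono h)

/-- Rejecting men who do not propose has no effect. -/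
theorem rejections_eq {R R' : Set M} (h : R ⊆ R') (hs : suitors menPref ℓ w R ∩ R' ⊆ R) :
    rejections menPref ℓ w R = rejections menPref ℓ w R' := by
  refine (rejections_mono h).antisymm (rejections_subset ?_)
  refine rejectStep_eq_of_congr (rejectStep_rejections R) fun v => ?_
  by_cases hv : v = w
  · subst hv
    rw [rejectAt_self, rejectAt_self]
    ext m
    rw [mem_rejectSet, mem_rejectSet]
    exact ⟨fun hm => ⟨hm.1, hs hm⟩, fun hm => ⟨hm.1, h hm.2⟩⟩
  · rw [rejectAt_of_ne _ hv, rejectAt_of_ne _ hv]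

theorem holds_rejections_iff {R : Set M} {m : M} :
    Holds menPref (rejections menPref ℓ w R) m w ↔ m ∈ suitors menPref ℓ w R ∧ m ∉ R := by
  have : (m, w) ∈ rejections menPref ℓ w R ↔ m ∈ suitors menPref ℓ w R ∧ m ∈ R := by
    conv_lhs => rw [← rejectStep_rejections]
    rw [mem_rejectStep, rejectAt_self, mem_rejectSet]
    rfl
  rw [Holds, this]
  change m ∈ suitors menPref ℓ w R ∧ _ ↔ _
  tauto

/-- If m did not propose while exempt from rejection, rejecting him as well would change nothing,
and he would never propose. -/
theorem mem_suitors_compl_self {m : M} (hm : m ∈ suitors menPref ℓ w Set.univ) :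
    m ∈ suitors menPref ℓ w {m}ᶜ := by
  by_contra h
  refine h ?_
  rw [suitors, rejections_eq (Set.subset_univ _)]
  · exact hm
  · rintro x ⟨hx, -⟩ hxm
    rw [Set.mem_singleton_iff] at hxm
    exact h (hxm ▸ hx)

theorem rejections_compl_eq_of_disjoint {m : M} {Y : Set M}
    (hY : ∀ y ∈ Y, y ∉ suitors menPref ℓ w {m}ᶜ) :
    rejections menPref ℓ w (insert m Y)ᶜ = rejections menPref ℓ w {m}ᶜ := by
  have hsub : (insert m Y)ᶜ ⊆ ({m} : Set M)ᶜ :=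
    Set.compl_subset_compl.2 (Set.singleton_subset_iff.2 (Set.mem_insert _ _))
  refine rejections_eq hsub ?_
  rintro x ⟨hx, hxm⟩ hc
  rcases hc with h | h
  · exact hxm h
  · exact hY x h (suitors_mono hsub hx)

/-- Since y does not propose when only m is exempt, exempting y too has no effect; withdrawing the
exemption of m then only adds rejections. -/
theorem rejections_subset_of_notMem {m y : M} (hy : y ∉ suitors menPref ℓ w {m}ᶜ) :
    rejections menPref ℓ w {m}ᶜ ⊆ rejections menPref ℓ w {y}ᶜ := by
  rw [← rejections_compl_eq_of_disjoint (Y := {y}) (by simpa using hy)]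
  exact rejections_mono (Set.compl_subset_compl.2 (Set.subset_insert _ _))

theorem mem_suitors_pair {y z : M} (hy : y ∈ suitors menPref ℓ w {z}ᶜ) :
    y ∈ suitors menPref ℓ w {z, y}ᶜ := by
  by_contra h
  have hsub : ({z, y} : Set M)ᶜ ⊆ {z}ᶜ :=
    Set.compl_subset_compl.2 (Set.singleton_subset_iff.2 (Set.mem_insert _ _))
  have heq : rejections menPref ℓ w {z, y}ᶜ = rejections menPref ℓ w {z}ᶜ := by
    refine rejections_eq hsub ?_
    rintro x ⟨hx, hxz⟩ hc
    rcases hc with h' | h'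
    · exact hxz h'
    · rw [Set.mem_singleton_iff] at h'
      exact h (h' ▸ hx)
  rw [suitors, heq] at h
  exact h hy

/-- If the sets were incomparable, y and z would both propose when exactly these two are exempt, and
w would hold two men. But that outcome has at least the rejections of the one where only m is
exempt, in which she holds at most one man, and more rejections cannot increase the number she
holds. -/
theorem suitors_comparable [Fintype M] [Fintype W] {m y z : M}
    (hy : y ∉ suitors menPref ℓ w {m}ᶜ) (hz : z ∉ suitors menPref ℓ w {m}ᶜ) :
    suitors menPref ℓ w {y}ᶜ ⊆ suitors menPref ℓ w {z}ᶜ ∨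
      suitors menPref ℓ w {z}ᶜ ⊆ suitors menPref ℓ w {y}ᶜ := by
  classical
  by_contra! hc
  obtain ⟨h1, h2⟩ := hc
  have hzy : z ∈ suitors menPref ℓ w {y}ᶜ := by
    by_contra h
    exact h1 (suitors_mono_of_subset (rejections_subset_of_notMem h))
  have hyz : y ∈ suitors menPref ℓ w {z}ᶜ := by
    by_contra h
    exact h2 (suitors_mono_of_subset (rejections_subset_of_notMem h))
  have hne : y ≠ z := by rintro rfl; exact h1 subset_rfl
  have hzy' := mem_suitors_pair hzy
  have hyz' := mem_suitors_pair hyz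
  rw [Set.pair_comm] at hyz'
  have hsub : rejections menPref ℓ w {m}ᶜ ⊆ rejections menPref ℓ w {y, z}ᶜ := by
    rw [← rejections_compl_eq_of_disjoint (Y := {y, z})
      (by rintro x (rfl | rfl); exacts [hy, hz])]
    exact rejections_mono (Set.compl_subset_compl.2 (Set.subset_insert _ _))
  have hcard := card_holds_le_of_subset_of_forall_ne (rejectStep_rejections {m}ᶜ)
    (rejectStep_rejections {y, z}ᶜ) hsub ℓ (fun v hv => rejectAt_of_ne _ hv)
    (fun v hv => rejectAt_of_ne _ hv)
  have hle : (Finset.univ.filter fun x =>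
      Holds menPref (rejections menPref ℓ w {m}ᶜ) x w).card ≤ 1 := by
    refine Finset.card_le_one.2 fun a ha b hb => ?_
    rw [Finset.mem_filter, holds_rejections_iff] at ha hb
    have ha' : a = m := by simpa using ha.2.2
    have hb' : b = m := by simpa using hb.2.2
    rw [ha', hb']
  have hlt : 1 < (Finset.univ.filter fun x =>
      Holds menPref (rejections menPref ℓ w {y, z}ᶜ) x w).card := by
    refine Finset.one_lt_card.2 ⟨y, ?_, z, ?_, hne⟩
    · rw [Finset.mem_filter, holds_rejections_iff]; exact ⟨Finset.mem_univ _, hyz', by simp⟩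
    · rw [Finset.mem_filter, holds_rejections_iff]; exact ⟨Finset.mem_univ _, hzy', by simp⟩
  omega

/-- If `w` is matched with `m` in a stable matching, then the outcome is the same when `w`
rejects everyone but `m`. -/
theorem rejectStep_compl_of_holds {F : Set (M × W)}
    (hF : rejectStep menPref (fun v => rejectList (ℓ v)) F = F) {m : M}
    (hm : Holds menPref F m w) : rejectStep menPref (rejectAt ℓ w {m}ᶜ) F = F := by
  refine rejectStep_eq_of_congr hF fun v => ?_
  by_cases hv : v = w
  · subst hv
    rw [rejectAt_self]
    ext x
    rw [mem_rejectSet, ← mem_rejectStep (menPref := menPref)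
      (ρ := fun v => rejectList (ℓ v)) (w := v), hF]
    constructor
    · rintro ⟨hx, hxm⟩
      by_contra hc
      exact hxm (Holds.unique_left hF rfl ⟨hx, hc⟩ hm)
    · intro hx
      refine ⟨?_, ?_⟩
      · rw [← hF, mem_rejectStep] at hx
        exact hx.1
      · rintro rfl
        exact hm.2 hx
  · rw [rejectAt_of_ne _ hv]

/-- Converse to `rejectStep_compl_of_holds`: if m has proposed and is the favourite among the
proposers, following the list amounts to rejecting everyone but m. -/
theorem rejectStep_of_compl {F : Set (M × W)} {m : M}
    (hF : rejectStep menPref (rejectAt ℓ w {m}ᶜ) F = F) (hl : m ∈ ℓ w)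
    (hm : Proposes menPref F m w)
    (hbest : ∀ x, Proposes menPref F x w → ¬ (ℓ w).idxOf x < (ℓ w).idxOf m) :
    rejectStep menPref (fun v => rejectList (ℓ v)) F = F := by
  refine rejectStep_eq_of_congr hF fun v => ?_
  by_cases hv : v = w
  · subst hv
    rw [rejectAt_self]
    ext x
    rw [mem_rejectSet, mem_rejectList]
    refine and_congr_right fun hx => ⟨?_, fun hxm => Or.inr ⟨m, hm, ?_⟩⟩
    · rintro (h | ⟨y, hy, hlt⟩)
      · rintro rfl
        exact h hl
      · rintro rfl
        exact hbest y hy hlt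
    · refine lt_of_le_of_ne (not_lt.1 (hbest x hx)) fun heq => hxm ?_
      exact ((List.idxOf_inj hl).1 heq).symm
  · rw [rejectAt_of_ne _ hv]

/-- F contains the least fixed point for the rule that exempts only m. With fewer rejections w holds
at least as many men there, hence somebody, and it can only be m. -/
theorem mem_suitors_of_holds [Fintype M] [Fintype W] {F : Set (M × W)}
    (hF : rejectStep menPref (fun v => rejectList (ℓ v)) F = F) {m : M}
    (hm : Holds menPref F m w) : m ∈ suitors menPref ℓ w Set.univ := by
  classical
  refine suitors_mono (Set.subset_univ {m}ᶜ) ?_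
  have hF' := rejectStep_compl_of_holds hF hm
  have hcard := card_holds_le_of_subset_of_forall_ne (rejectStep_rejections {m}ᶜ) hF'
    (rejections_subset hF') ℓ (fun v hv => rejectAt_of_ne _ hv) (fun v hv => rejectAt_of_ne _ hv)
  have hpos : 0 < (Finset.univ.filter fun x => Holds menPref F x w).card :=
    Finset.card_pos.2 ⟨m, by simpa using hm⟩
  obtain ⟨x, hx⟩ := Finset.card_pos.1 (hpos.trans_le hcard)
  rw [Finset.mem_filter, holds_rejections_iff] at hx
  have hxm : x = m := by simpa using hx.2.2
  exact hxm ▸ hx.2.1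

theorem best_of_holds {F : Set (M × W)}
    (hF : rejectStep menPref (fun v => rejectList (ℓ v)) F = F) {m : M}
    (hm : Holds menPref F m w) :
    ∀ x ∈ suitors menPref ℓ w {m}ᶜ, ¬ (ℓ w).idxOf x < (ℓ w).idxOf m := fun x hx =>
  (hm.best hF rfl).2 x
    (Proposes.mono (rejections_subset (rejectStep_compl_of_holds hF hm)) hx)

/-- Each of the two least fixed points is also a fixed point of the other rule, so each contains the
other. -/
theorem menOptimal_eq_rejections [Fintype M] [Fintype W] {m : M}
    (hm : Holds menPref (menOptimal menPref ℓ) m w) :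
    menOptimal menPref ℓ = rejections menPref ℓ w {m}ᶜ := by
  have h1 := rejectStep_menOptimal (menPref := menPref) (ℓ := ℓ)
  refine (menOptimal_subset ?_).antisymm (rejections_subset (rejectStep_compl_of_holds h1 hm))
  exact rejectStep_of_compl (rejectStep_rejections _) (hm.best h1 rfl).1
    (mem_suitors_compl_self (mem_suitors_of_holds h1 hm)) (best_of_holds h1 hm)

/-- Such a y has already proposed in the men-optimal outcome, and was not rejected there because he
is not rejected in the larger F; so he is held. -/
theorem eq_of_holds_of_mem_suitors [Fintype M] [Fintype W] {m y : M} {F : Set (M × W)}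
    (hm : Holds menPref (menOptimal menPref ℓ) m w)
    (hF : rejectStep menPref (fun v => rejectList (ℓ v)) F = F) (hy : Holds menPref F y w)
    (hys : y ∈ suitors menPref ℓ w {m}ᶜ) : y = m := by
  have hp : Proposes menPref (menOptimal menPref ℓ) y w := by
    rw [menOptimal_eq_rejections hm]; exact hys
  exact Holds.unique_left rejectStep_menOptimal rfl
    ⟨hp, fun h => hy.2 (menOptimal_subset hF h)⟩ hm

/-- Exempting only b gives a stable outcome, so b proposes in the greatest fixed point. The man held
there is also among the suitors, so neither can be strictly preferred to the other. -/
theorem holds_womenOptimal [Fintype M] [Fintype W] {b : M}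
    (hb : b ∈ suitors menPref ℓ w Set.univ) (hl : b ∈ ℓ w)
    (hbest : ∀ x ∈ suitors menPref ℓ w Set.univ, ¬ (ℓ w).idxOf x < (ℓ w).idxOf b) :
    Holds menPref (womenOptimal menPref ℓ) b w := by
  have hs := mem_suitors_compl_self hb
  have hfix := rejectStep_of_compl (rejectStep_rejections {b}ᶜ) hl hs
    fun x hx => hbest x (suitors_mono (Set.subset_univ _) hx)
  have hp : Proposes menPref (womenOptimal menPref ℓ) b w :=
    Proposes.mono (subset_womenOptimal hfix) hs
  have hwo := rejectStep_womenOptimal (menPref := menPref) (ℓ := ℓ)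
  obtain ⟨x, hx⟩ := exists_holds hwo (w := w) rfl hp hl
  have hle := (hx.best hwo rfl).2 b hp
  have hle' := hbest x (mem_suitors_of_holds hwo hx)
  have : b = x := (List.idxOf_inj hl).1 (le_antisymm (not_lt.1 hle') (not_lt.1 hle))
  exact this ▸ hx

/-- She holds her favourite suitor in the women-optimal outcome, and at least as many men in the
men-optimal one. -/
theorem exists_holds_menOptimal [Fintype M] [Fintype W] {m : M}
    (hm : m ∈ suitors menPref ℓ w Set.univ) (hl : m ∈ ℓ w) :
    ∃ x, Holds menPref (menOptimal menPref ℓ) x w := by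
  classical
  obtain ⟨b, hb, hbl, hbest⟩ := exists_best hm hl
  have h := holds_womenOptimal hb hbl hbest
  have hcard := card_holds_le_of_subset_of_forall_ne rejectStep_menOptimal
    rejectStep_womenOptimal (menOptimal_subset_womenOptimal (menPref := menPref) (ℓ := ℓ))
    (w := w) ℓ (fun _ _ => rfl) (fun _ _ => rfl)
  have hpos : 0 < (Finset.univ.filter fun x =>
      Holds menPref (womenOptimal menPref ℓ) x w).card :=
    Finset.card_pos.2 ⟨b, by simpa using h⟩
  obtain ⟨x, hx⟩ := Finset.card_pos.1 (hpos.trans_le hcard)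
  exact ⟨x, (Finset.mem_filter.1 hx).2⟩

/-- Whether `m` is the partner of `w` in the stable matching that is best for the men depends
only on how `w` compares the men who propose to her when she rejects everyone but `m`. -/
theorem holds_menOptimal_of_congr [Fintype M] [Fintype W] {ℓ' : W → List M} {m : M}
    (hne : ∀ v ≠ w, ℓ' v = ℓ v)
    (hmem : ∀ x, x ∈ ℓ' w ↔ x ∈ ℓ w)
    (hlt : ∀ x ∈ suitors menPref ℓ w {m}ᶜ, ∀ y ∈ suitors menPref ℓ w {m}ᶜ, x ∈ ℓ w → y ∈ ℓ w →
      ((ℓ' w).idxOf x < (ℓ' w).idxOf y ↔ (ℓ w).idxOf x < (ℓ w).idxOf y))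
    (hm : Holds menPref (menOptimal menPref ℓ) m w) :
    Holds menPref (menOptimal menPref ℓ') m w := by
  have h1 := rejectStep_menOptimal (menPref := menPref) (ℓ := ℓ)
  have heq := menOptimal_eq_rejections hm
  have hcongr : ∀ S ⊆ suitors menPref ℓ w {m}ᶜ,
      rejectList (ℓ' w) S = rejectList (ℓ w) S := by
    intro S hS
    ext x
    rw [mem_rejectList, mem_rejectList, hmem]
    refine and_congr_right fun hx => ?_
    by_cases hxl : x ∈ ℓ w
    · refine or_congr_right ⟨?_, ?_⟩
      · rintro ⟨y, hy, h⟩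
        have hyl : y ∈ ℓ w := (hmem y).1
          (List.idxOf_lt_length_iff.1 (h.trans (List.idxOf_lt_length_of_mem ((hmem x).2 hxl))))
        exact ⟨y, hy, (hlt y (hS hy) x (hS hx) hyl hxl).1 h⟩
      · rintro ⟨y, hy, h⟩
        have hyl : y ∈ ℓ w :=
          List.idxOf_lt_length_iff.1 (h.trans (List.idxOf_lt_length_of_mem hxl))
        exact ⟨y, hy, (hlt y (hS hy) x (hS hx) hyl hxl).2 h⟩
    · simp [hxl]
  -- Below the men-optimal fixed point only men of `suitors menPref ℓ w {m}ᶜ` have proposed to w, so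
  -- the two lists of w are compared only on that set.
  have hprop : ∀ F ⊆ menOptimal menPref ℓ,
      {x | Proposes menPref F x w} ⊆ suitors menPref ℓ w {m}ᶜ := by
    intro F hF x hx
    rw [suitors, ← heq]
    exact Proposes.mono hF hx
  have hrule : ∀ F ⊆ menOptimal menPref ℓ, ∀ v,
      rejectList (ℓ' v) {x | Proposes menPref F x v}
        = rejectList (ℓ v) {x | Proposes menPref F x v} := by
    intro F hF v
    by_cases hv : v = w
    · subst hv; exact hcongr _ (hprop F hF)
    · rw [hne v hv]
  have hsub : menOptimal menPref ℓ' ⊆ menOptimal menPref ℓ :=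
    menOptimal_subset (rejectStep_eq_of_congr h1 (hrule _ subset_rfl))
  have : menOptimal menPref ℓ' = menOptimal menPref ℓ :=
    hsub.antisymm (menOptimal_subset (rejectStep_eq_of_congr rejectStep_menOptimal
      fun v => (hrule _ hsub v).symm))
  rw [this]
  exact hm

open scoped Classical in
/-- The number of men who can still propose to `w` after she rejects `m`, with `m` included,
is at most the number of couples that can be formed. -/
theorem card_suitors_sdiff_lt [Fintype M] [Fintype W] {m : M}
    (hm : m ∈ suitors menPref ℓ w Set.univ) :
    (Finset.univ.filter fun x => x ∈ suitors menPref ℓ w Set.univ ∧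
        x ∉ suitors menPref ℓ w {m}ᶜ).card + 1
      ≤ min (Fintype.card M) (Fintype.card W) := by
  have hs := mem_suitors_compl_self hm
  set G := rejections menPref ℓ w {m}ᶜ with hG
  -- A man held by nobody has been rejected by every woman on his list, so he would have proposed to
  -- w; the men counted are therefore all held in G.
  have hsub : insert m (Finset.univ.filter fun x => x ∈ suitors menPref ℓ w Set.univ ∧
        x ∉ suitors menPref ℓ w {m}ᶜ)
      ⊆ Finset.univ.filter fun x => ∃ v, Holds menPref G x v := by
    intro x hx
    rw [Finset.mem_filter]
    refine ⟨Finset.mem_univ _, ?_⟩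
    rcases Finset.mem_insert.1 hx with rfl | hx
    · exact ⟨w, holds_rejections_iff.2 ⟨hs, by simp⟩⟩
    · obtain ⟨-, hx, hxs⟩ := Finset.mem_filter.1 hx
      by_contra hc
      have hall : ∀ v ∈ menPref x, (x, v) ∈ G := fun v hv =>
        mem_of_not_holds (not_exists.1 hc) hv
      refine hxs ⟨hx.1, fun v hv => hall v ?_⟩
      exact List.idxOf_lt_length_iff.1 (hv.trans (List.idxOf_lt_length_of_mem hx.1))
  have hcard := Finset.card_le_card hsub
  rw [Finset.card_insert_of_notMem (by simp [hs])] at hcard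
  refine hcard.trans (le_min (Finset.card_le_univ _) ?_)
  rw [card_exists_holds]
  calc _ ≤ ∑ _v : W, 1 := Finset.sum_le_sum fun v _ => ?_
    _ = _ := by simp
  by_cases hv : v = w
  · subst hv
    refine Finset.card_le_one.2 fun a ha b hb => ?_
    rw [Finset.mem_filter, holds_rejections_iff] at ha hb
    have ha' : a = m := by simpa using ha.2.2
    have hb' : b = m := by simpa using hb.2.2
    rw [ha', hb']
  · exact card_holds_le_one (rejectStep_rejections _) (rejectAt_of_ne _ hv)

end

/-! ### Stable partners of one woman, averaged over her list -/

theorem idxOf_filter_lt_iff {α : Type*} [DecidableEq α] (p : α → Bool) (l : List α) {x y : α}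
    (hx : p x) (hy : p y) :
    (l.filter p).idxOf x < (l.filter p).idxOf y ↔ l.idxOf x < l.idxOf y := by
  induction l with
  | nil => simp
  | cons a l ih =>
    by_cases hax : a = x
    · subst hax
      rw [List.filter_cons_of_pos hx]
      by_cases hay : a = y
      · subst hay; simp
      · simp [List.idxOf_cons_ne _ hay]
    · by_cases hay : a = y
      · subst hay
        rw [List.filter_cons_of_pos hy]
        simp
      · by_cases ha : p a
        · rw [List.filter_cons_of_pos ha]
          simp only [List.idxOf_cons_ne _ hax, List.idxOf_cons_ne _ hay]
          omega
        · rw [List.filter_cons_of_neg ha, List.idxOf_cons_ne _ hax, List.idxOf_cons_ne _ hay, ih]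
          omega

open scoped Classical in
/-- The men with whom `w` is matched in some stable matching, in terms of fixed points of
deferred acceptance. -/
noncomputable def stableHusbands {M W : Type*} [Fintype M] [DecidableEq M] [DecidableEq W]
    (menPref : M → List W) (ℓ : W → List M) (w : W) : Finset M :=
  Finset.univ.filter fun m =>
    ∃ F, rejectStep menPref (fun v => rejectList (ℓ v)) F = F ∧ Holds menPref F m w

open scoped Classical in
/-- The sum of `g` over the men held by `w`. -/
noncomputable def heldSum {M W : Type*} [Fintype M] [DecidableEq W]
    (menPref : M → List W) (F : Set (M × W)) (w : W) (g : M → ℝ) : ℝ :=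
  ∑ m, if Holds menPref F m w then g m else 0

section

variable {M W : Type*} [DecidableEq M] [DecidableEq W] {menPref : M → List W}

open scoped Classical in
/-- The men in `A` who propose to `w` when she rejects the men in `R`. -/
noncomputable def acceptableSuitors (menPref : M → List W) (ℓ : W → List M) (w : W)
    (A : Finset M) (R : Set M) : Finset M := A.filter fun m => m ∈ suitors menPref ℓ w R

theorem mem_acceptableSuitors {ℓ : W → List M} {w : W} {A : Finset M} {R : Set M} {m : M} :
    m ∈ acceptableSuitors menPref ℓ w A R ↔ m ∈ A ∧ m ∈ suitors menPref ℓ w R := by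
  classical
  exact Finset.mem_filter

theorem acceptableSuitors_mono {ℓ : W → List M} {w : W} {A : Finset M} {R R' : Set M}
    (h : R ⊆ R') :
    acceptableSuitors menPref ℓ w A R ⊆ acceptableSuitors menPref ℓ w A R' := fun m hm => by
  rw [mem_acceptableSuitors] at hm ⊢
  exact ⟨hm.1, suitors_mono h hm.2⟩

variable [Fintype M]

theorem heldSum_eq {ρ : W → Set M →o Set M} {F : Set (M × W)}
    (hF : rejectStep menPref ρ F = F) {w : W} {l : List M} (hw : ρ w = rejectList l) {m : M}
    (hm : Holds menPref F m w) (g : M → ℝ) : heldSum menPref F w g = g m := by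
  classical
  rw [heldSum, Finset.sum_eq_single m, if_pos hm]
  · intro x _ hx
    exact if_neg fun h => hx (h.unique_left hF hw hm)
  · simp

theorem mem_stableHusbands {ℓ : W → List M} {w : W} {m : M} :
    m ∈ stableHusbands menPref ℓ w ↔
      ∃ F, rejectStep menPref (fun v => rejectList (ℓ v)) F = F ∧ Holds menPref F m w := by
  classical
  simp [stableHusbands]

variable [Fintype W]

open scoped Classical in
theorem holds_menOptimal_filter (ℓ : W → List M) (w : W) {A : Finset M} (m : M) :
    ∃ φ : List M → ℝ, ∀ l ∈ preferenceLists A,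
      (if Holds menPref (menOptimal menPref (Function.update ℓ w l)) m w then (1 : ℝ) else 0)
        = φ (l.filter (· ∈ acceptableSuitors menPref ℓ w A {m}ᶜ)) := by
  set S := acceptableSuitors menPref ℓ w A {m}ᶜ with hS
  -- The indicator is read off from any list with the given restriction; `holds_menOptimal_of_congr`
  -- makes the choice irrelevant.
  refine ⟨fun k => if ∃ l ∈ preferenceLists A, l.filter (· ∈ S) = k ∧
    Holds menPref (menOptimal menPref (Function.update ℓ w l)) m w then 1 else 0,
    fun l hl => ?_⟩
  refine if_congr ⟨fun h => ⟨l, hl, rfl, h⟩, ?_⟩ rfl rfl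
  rintro ⟨l', hl', heq, h⟩
  refine holds_menOptimal_of_congr (ℓ := Function.update ℓ w l') (w := w) ?_ ?_ ?_ h
  · intro v hv
    rw [Function.update_of_ne hv, Function.update_of_ne hv]
  · intro x
    rw [Function.update_self, Function.update_self, mem_of_mem_preferenceLists hl,
      mem_of_mem_preferenceLists hl']
  · intro x hx y hy hxl hyl
    rw [Function.update_self, mem_of_mem_preferenceLists hl'] at hxl hyl
    rw [suitors_update] at hx hy
    rw [Function.update_self, Function.update_self,
      ← idxOf_filter_lt_iff (· ∈ S) l (by simpa [hS, mem_acceptableSuitors] using ⟨hxl, hx⟩)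
        (by simpa [hS, mem_acceptableSuitors] using ⟨hyl, hy⟩),
      ← idxOf_filter_lt_iff (· ∈ S) l' (by simpa [hS, mem_acceptableSuitors] using ⟨hxl, hx⟩)
        (by simpa [hS, mem_acceptableSuitors] using ⟨hyl, hy⟩), heq]

/-- Given that `m` is the partner of `w` in the stable matching that is best for the men, the
expected number of stable partners of `w` is bounded by the expected gain of `w` between the
stable matching that is best for the men and the one that is best for the women. -/
theorem listMean_card_stableHusbands_le_of_holds (ℓ : W → List M) (w : W) {A : Finset M}
    {D : M → ℝ} (hD : ∀ a ∈ A, 0 < D a) {c : ℝ}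
    (hc : ∀ k : ℕ, k ≤ A.card → k ≤ min (Fintype.card M) (Fintype.card W) → (k : ℝ) ≤ c)
    {m : M} (hm : m ∈ acceptableSuitors menPref ℓ w A Set.univ) (f : List M → ℝ)
    (hf : ∀ l ∈ preferenceLists A, f l = 0 ∨
      (f l = 1 ∧ Holds menPref (menOptimal menPref (Function.update ℓ w l)) m w))
    (φ : List M → ℝ) (hφ : ∀ l ∈ preferenceLists A,
      f l = φ (l.filter (· ∈ acceptableSuitors menPref ℓ w A {m}ᶜ))) :
    listMean D A (fun l =>
        f l * (stableHusbands menPref (Function.update ℓ w l) w).card)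
      ≤ listMean D A (fun l => f l * (1 + Real.log c - Real.log (D m)
          + heldSum menPref (womenOptimal menPref (Function.update ℓ w l)) w
            (fun x => Real.log (D x)))) := by
  classical
  set X := acceptableSuitors menPref ℓ w A Set.univ with hX
  set S : M → Finset M := fun y => acceptableSuitors menPref ℓ w A {y}ᶜ with hS
  have hXA : X ⊆ A := fun x hx => (mem_acceptableSuitors.1 hx).1
  have hSX : ∀ y, S y ⊆ X := fun y => acceptableSuitors_mono (Set.subset_univ _)
  have hself : ∀ y ∈ X, y ∈ S y := fun y hy => by
    rw [hX, mem_acceptableSuitors] at hy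
    exact mem_acceptableSuitors.2 ⟨hy.1, mem_suitors_compl_self hy.2⟩
  have hnot : ∀ y ∈ X \ S m, y ∉ suitors menPref ℓ w {m}ᶜ := fun y hy h => by
    rw [Finset.mem_sdiff] at hy
    exact hy.2 (mem_acceptableSuitors.2 ⟨hXA hy.1, h⟩)
  have hSS : ∀ y ∈ X \ S m, S m ⊆ S y := fun y hy x hx => by
    rw [hS, mem_acceptableSuitors] at hx ⊢
    exact ⟨hx.1, suitors_mono_of_subset (rejections_subset_of_notMem (hnot y hy)) hx.2⟩
  have hcomp : ∀ y ∈ X \ S m, ∀ z ∈ X \ S m, S y ⊆ S z ∨ S z ⊆ S y := by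
    intro y hy z hz
    refine (suitors_comparable (hnot y hy) (hnot z hz)).imp (fun h x hx => ?_) (fun h x hx => ?_)
    all_goals
      rw [hS, mem_acceptableSuitors] at hx ⊢
      exact ⟨hx.1, h hx.2⟩
  set q := listMean D A f with hq
  have hf0 : ∀ l ∈ preferenceLists A, 0 ≤ f l := fun l hl => by
    rcases hf l hl with h | h
    · exact h.ge
    · rw [h.1]; exact zero_le_one
  have hq0 : 0 ≤ q := by
    have := listMean_mono hD (f := fun _ => 0) (g := f) hf0
    rwa [listMean_const hD] at this
  -- Here f is a function of the order on S m alone, so it factors out of the event that y ∉ S m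
  -- comes first in Q.
  have hfirst : ∀ Q, S m ⊆ Q → Q ⊆ A → ∀ y ∈ Q, y ∉ S m →
      listMean D A (fun l => if ∀ x ∈ Q, ¬ l.idxOf x < l.idxOf y then f l else 0)
        = D y / (∑ b ∈ Q, D b) * q := by
    intro Q hSQ hQA y hy hyS
    rw [hq, listMean_congr D hφ, ← listMean_filter_first hD hQA hSQ hy hyS]
    exact listMean_congr D fun l hl => by simp only [hφ l hl, hS]
  have hup : listMean D A (fun l =>
        f l * (stableHusbands menPref (Function.update ℓ w l) w).card)
      ≤ q * (1 + ∑ y ∈ X \ S m, D y / ∑ b ∈ S y, D b) := by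
    -- Apart from m, a stable partner y lies outside S m and comes first in his own S y.
    have hle : ∀ l ∈ preferenceLists A,
        f l * (stableHusbands menPref (Function.update ℓ w l) w).card
          ≤ f l + ∑ y ∈ X \ S m, if ∀ x ∈ S y, ¬ l.idxOf x < l.idxOf y then f l else 0 := by
      intro l hl
      rcases hf l hl with h | ⟨h, hh⟩
      · simp [h]
      · rw [h, one_mul, Finset.sum_boole]
        have hsub : stableHusbands menPref (Function.update ℓ w l) w ⊆ insert m
            ((X \ S m).filter fun y => ∀ x ∈ S y, ¬ l.idxOf x < l.idxOf y) := by
          intro y hy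
          obtain ⟨F, hF, hyF⟩ := mem_stableHusbands.1 hy
          by_cases hym : y = m
          · exact Finset.mem_insert.2 (Or.inl hym)
          · refine Finset.mem_insert_of_mem (Finset.mem_filter.2 ⟨Finset.mem_sdiff.2 ⟨?_, ?_⟩, ?_⟩)
            · have h1 := mem_suitors_of_holds hF hyF
              rw [suitors_update] at h1
              have h2 := (hyF.best hF rfl).1
              rw [Function.update_self, mem_of_mem_preferenceLists hl] at h2
              exact mem_acceptableSuitors.2 ⟨h2, h1⟩
            · intro hyS
              refine hym (eq_of_holds_of_mem_suitors hh hF hyF ?_)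
              rw [suitors_update]
              exact (mem_acceptableSuitors.1 hyS).2
            · intro x hx
              have h3 := best_of_holds hF hyF x (by
                rw [suitors_update]; exact (mem_acceptableSuitors.1 hx).2)
              rwa [Function.update_self] at h3
        have hcard := (Finset.card_le_card hsub).trans (Finset.card_insert_le _ _)
        have : ((stableHusbands menPref (Function.update ℓ w l) w).card : ℝ) ≤
          ((((X \ S m).filter fun y => ∀ x ∈ S y, ¬ l.idxOf x < l.idxOf y).card + 1 : ℕ) : ℝ) :=
          Nat.cast_le.2 hcard
        push_cast at this
        linarith
    refine (listMean_mono hD hle).trans_eq ?_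
    rw [listMean_add, listMean_sum, mul_add, mul_one, Finset.mul_sum]
    congr 1
    refine Finset.sum_congr rfl fun y hy => ?_
    have hy' := Finset.mem_sdiff.1 hy
    rw [hfirst (S y) (hSS y hy) ((hSX y).trans hXA) y (hself y hy'.1) hy'.2, mul_comm]
  have hlow : listMean D A (fun l => f l * (1 + Real.log c - Real.log (D m)
          + heldSum menPref (womenOptimal menPref (Function.update ℓ w l)) w
            (fun x => Real.log (D x))))
      = q * (1 + Real.log c + ∑ y ∈ X \ S m, D y / (∑ b ∈ X, D b)
          * (Real.log (D y) - Real.log (D m))) := by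
    -- The women-optimal partner is the favourite b of X. If b ∈ S m then b = m and the gain
    -- vanishes, so only y outside S m contribute.
    have heq : ∀ l ∈ preferenceLists A, f l * (1 + Real.log c - Real.log (D m)
          + heldSum menPref (womenOptimal menPref (Function.update ℓ w l)) w
            (fun x => Real.log (D x)))
        = (1 + Real.log c) * f l + ∑ y ∈ X \ S m, (Real.log (D y) - Real.log (D m))
            * (if ∀ x ∈ X, ¬ l.idxOf x < l.idxOf y then f l else 0) := by
      intro l hl
      rcases hf l hl with h | ⟨h, hh⟩
      · simp [h]
      · obtain ⟨b, hb, hbl, hbest⟩ := exists_best (l := l) (S := (X : Set M)) (m := m) hm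
          ((mem_of_mem_preferenceLists hl).2 (hXA hm))
        have hbest' : ∀ x ∈ X, ¬ l.idxOf x < l.idxOf b := hbest
        have hiff : ∀ y ∈ X, (∀ x ∈ X, ¬ l.idxOf x < l.idxOf y) ↔ y = b := by
          intro y hy
          refine ⟨fun hy' => ?_, fun hy' => hy' ▸ hbest'⟩
          exact ((List.idxOf_inj hbl).1
            (le_antisymm (not_lt.1 (hbest' y hy)) (not_lt.1 (hy' b hb)))).symm
        have hhold : Holds menPref (womenOptimal menPref (Function.update ℓ w l)) b w := by
          refine holds_womenOptimal ?_ ?_ ?_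
          · rw [suitors_update]; exact (mem_acceptableSuitors.1 hb).2
          · rwa [Function.update_self]
          · intro x hx
            rw [suitors_update] at hx
            rw [Function.update_self]
            intro hlt
            have hxl : x ∈ l :=
              List.idxOf_lt_length_iff.1 (hlt.trans (List.idxOf_lt_length_of_mem hbl))
            exact hbest' x (mem_acceptableSuitors.2
              ⟨(mem_of_mem_preferenceLists hl).1 hxl, hx⟩) hlt
        rw [heldSum_eq rejectStep_womenOptimal rfl hhold, h]
        have hsum : ∑ y ∈ X \ S m, (Real.log (D y) - Real.log (D m))
            * (if ∀ x ∈ X, ¬ l.idxOf x < l.idxOf y then (1 : ℝ) else 0)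
            = ∑ y ∈ X \ S m, if y = b then (Real.log (D b) - Real.log (D m)) else 0 := by
          refine Finset.sum_congr rfl fun y hy => ?_
          simp only [hiff y (Finset.mem_sdiff.1 hy).1]
          split_ifs with hyb
          · rw [hyb, mul_one]
          · rw [mul_zero]
        rw [hsum, Finset.sum_ite_eq']
        split_ifs with hbS
        · ring
        · have hbm : b = m := by
            have hbSm : b ∈ S m := by
              by_contra hc
              exact hbS (Finset.mem_sdiff.2 ⟨hb, hc⟩)
            refine eq_of_holds_of_mem_suitors hh rejectStep_womenOptimal hhold ?_
            rw [suitors_update]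
            exact (mem_acceptableSuitors.1 hbSm).2
          rw [hbm]; ring
    rw [listMean_congr D heq, listMean_add, listMean_mul_left, listMean_sum, mul_add,
      Finset.mul_sum, mul_comm]
    congr 1
    refine Finset.sum_congr rfl fun y hy => ?_
    have hy' := Finset.mem_sdiff.1 hy
    rw [listMean_mul_left, hfirst X (hSX m) hXA y hy'.1 hy'.2]
    ring
  rw [hlow]
  refine hup.trans (mul_le_mul_of_nonneg_left ?_ hq0)
  have hDX : ∀ a ∈ X, 0 < D a := fun a ha => hD a (hXA ha)
  have hU : S m ∪ (X \ S m) = X := Finset.union_sdiff_of_subset (hSX m)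
  have h1 := sum_div_chain_le_log (D := D) (S := S m) (U := X \ S m) S ⟨m, hself m hm⟩
    (fun y _ a ha => hDX a (hSX y ha)) Finset.disjoint_sdiff hSS
    (fun y hy => hself y (Finset.mem_sdiff.1 hy).1) hcomp
  have hcard : ((X \ S m).card : ℝ) + 1 ≤ c := by
    have h := hc ((X \ S m).card + 1) ?_ ?_
    · push_cast at h; exact h
    · rw [← Finset.card_insert_of_notMem (a := m) (s := X \ S m)
        (by simp [hself m hm])]
      exact Finset.card_le_card (Finset.insert_subset (hXA hm) (Finset.sdiff_subset.trans hXA))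
    · refine le_trans ?_ (card_suitors_sdiff_lt (mem_acceptableSuitors.1 hm).2)
      refine Nat.add_le_add_right (Finset.card_le_card fun x hx => ?_) 1
      rw [Finset.mem_filter]
      exact ⟨Finset.mem_univ _, (mem_acceptableSuitors.1 (Finset.mem_sdiff.1 hx).1).2, hnot x hx⟩
  have hXsum : ∑ b ∈ S m, D b + ∑ b ∈ X \ S m, D b = ∑ b ∈ X, D b := by
    rw [add_comm, Finset.sum_sdiff (hSX m)]
  have h2 := log_sub_log_le_entropy (D := D) (U := X \ S m) (d := D m) (s := ∑ b ∈ S m, D b)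
    (fun a ha => hDX a (Finset.mem_sdiff.1 ha).1) (hDX m hm)
    (Finset.single_le_sum (f := D) (fun a ha => (hDX a (hSX m ha)).le) (hself m hm)) hcard
  rw [hXsum] at h2
  rw [hU] at h1
  have hXpos : 0 < ∑ b ∈ X, D b := Finset.sum_pos hDX ⟨m, hm⟩
  -- All of the mass D(S m) / D(X) sits at b = m, which is the term with `d = D m` in the entropy
  -- bound.
  have h3 : ∑ y ∈ X \ S m, D y / (∑ b ∈ X, D b) * (Real.log (D y) - Real.log (D m))
      = ∑ y ∈ X \ S m, D y / (∑ b ∈ X, D b) * Real.log (D y)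
        + (∑ b ∈ S m, D b) / (∑ b ∈ X, D b) * Real.log (D m) - Real.log (D m) := by
    have : (∑ b ∈ S m, D b) / (∑ b ∈ X, D b) = 1 - ∑ y ∈ X \ S m, D y / (∑ b ∈ X, D b) := by
      rw [eq_sub_iff_add_eq, ← Finset.sum_div, ← add_div, hXsum, div_self hXpos.ne']
    rw [this]
    simp only [mul_sub, Finset.sum_sub_distrib, ← Finset.sum_mul]
    ring
  rw [h3]
  linarith

/-- The expected number of stable partners of `w`, over the randomness of her preference list. -/
theorem listMean_card_stableHusbands_le (ℓ : W → List M) (w : W) {A : Finset M}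
    {D : M → ℝ} (hD : ∀ a ∈ A, 0 < D a) {c : ℝ}
    (hc : ∀ k : ℕ, k ≤ A.card → k ≤ min (Fintype.card M) (Fintype.card W) → (k : ℝ) ≤ c) :
    listMean D A (fun l => ((stableHusbands menPref (Function.update ℓ w l) w).card : ℝ))
      ≤ listMean D A (fun l =>
          heldSum menPref (menOptimal menPref (Function.update ℓ w l)) w
            (fun x => 1 + Real.log c - Real.log (D x))
          + heldSum menPref (womenOptimal menPref (Function.update ℓ w l)) w
            (fun x => Real.log (D x))) := by
  classical
  set X := acceptableSuitors menPref ℓ w A Set.univ with hX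
  have hmemX : ∀ l ∈ preferenceLists A, ∀ F,
      rejectStep menPref (fun v => rejectList (Function.update ℓ w l v)) F = F →
      ∀ y, Holds menPref F y w → y ∈ X := by
    intro l hl F hF y hy
    have h1 := mem_suitors_of_holds hF hy
    rw [suitors_update] at h1
    have h2 := (hy.best hF rfl).1
    rw [Function.update_self, mem_of_mem_preferenceLists hl] at h2
    exact mem_acceptableSuitors.2 ⟨h2, h1⟩
  let f : M → List M → ℝ := fun m l =>
    if Holds menPref (menOptimal menPref (Function.update ℓ w l)) m w then 1 else 0
  rcases X.eq_empty_or_nonempty with h0 | ⟨x₀, hx₀⟩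
  · refine (listMean_congr D fun l hl => ?_).le
    have hno : ∀ F, rejectStep menPref (fun v => rejectList (Function.update ℓ w l v)) F = F →
        ∀ y, ¬ Holds menPref F y w := fun F hF y hy => by
      simpa [h0] using hmemX l hl F hF y hy
    have h1 : stableHusbands menPref (Function.update ℓ w l) w = ∅ :=
      Finset.eq_empty_of_forall_notMem fun y hy => by
        obtain ⟨F, hF, hy⟩ := mem_stableHusbands.1 hy
        exact hno F hF y hy
    have h2 : ∀ F, rejectStep menPref (fun v => rejectList (Function.update ℓ w l v)) F = F →
        ∀ g, heldSum menPref F w g = 0 := fun F hF g =>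
      Finset.sum_eq_zero fun y _ => if_neg (hno F hF y)
    rw [h1, h2 _ rejectStep_menOptimal, h2 _ rejectStep_womenOptimal]
    simp
  · have hex : ∀ l ∈ preferenceLists A, ∃ m ∈ X,
        Holds menPref (menOptimal menPref (Function.update ℓ w l)) m w := by
      intro l hl
      rw [hX, mem_acceptableSuitors] at hx₀
      obtain ⟨m, hm⟩ := exists_holds_menOptimal (menPref := menPref)
        (ℓ := Function.update ℓ w l) (w := w) (m := x₀) (by rw [suitors_update]; exact hx₀.2)
        (by rw [Function.update_self, mem_of_mem_preferenceLists hl]; exact hx₀.1)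
      exact ⟨m, hmemX l hl _ rejectStep_menOptimal m hm, hm⟩
    -- The indicators `f x` partition the lists according to the men-optimal partner, which reduces
    -- the bound to a fixed partner.
    have hsplit : ∀ l ∈ preferenceLists A, ∀ m ∈ X,
        Holds menPref (menOptimal menPref (Function.update ℓ w l)) m w → ∀ g : M → ℝ,
        ∑ x ∈ X, f x l * g x = g m := by
      intro l hl m hmX hm g
      rw [Finset.sum_eq_single_of_mem m hmX]
      · simp only [f]; rw [if_pos hm, one_mul]
      · intro x _ hx
        simp only [f]
        rw [if_neg fun h => hx (h.unique_left rejectStep_menOptimal rfl hm), zero_mul]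
    have h1 : ∀ l ∈ preferenceLists A,
        ((stableHusbands menPref (Function.update ℓ w l) w).card : ℝ)
          = ∑ x ∈ X, f x l * (stableHusbands menPref (Function.update ℓ w l) w).card := by
      intro l hl
      obtain ⟨m, hmX, hm⟩ := hex l hl
      exact (hsplit l hl m hmX hm fun _ => _).symm
    have h2 : ∀ l ∈ preferenceLists A,
        heldSum menPref (menOptimal menPref (Function.update ℓ w l)) w
            (fun x => 1 + Real.log c - Real.log (D x))
          + heldSum menPref (womenOptimal menPref (Function.update ℓ w l)) w
            (fun x => Real.log (D x))
          = ∑ x ∈ X, f x l * (1 + Real.log c - Real.log (D x)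
            + heldSum menPref (womenOptimal menPref (Function.update ℓ w l)) w
              (fun x => Real.log (D x))) := by
      intro l hl
      obtain ⟨m, hmX, hm⟩ := hex l hl
      rw [heldSum_eq rejectStep_menOptimal rfl hm]
      exact (hsplit l hl m hmX hm fun x => 1 + Real.log c - Real.log (D x)
            + heldSum menPref (womenOptimal menPref (Function.update ℓ w l)) w
              (fun x => Real.log (D x))).symm
    rw [listMean_congr D h1, listMean_congr D h2, listMean_sum, listMean_sum]
    refine Finset.sum_le_sum fun x hx => ?_
    obtain ⟨φ, hφ⟩ := holds_menOptimal_filter (menPref := menPref) ℓ w (A := A) x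
    refine listMean_card_stableHusbands_le_of_holds ℓ w hD hc hx (f x) (fun l _ => ?_) φ hφ
    simp only [f]
    split_ifs with h
    · exact Or.inr ⟨rfl, h⟩
    · exact Or.inl rfl

end

/-! ### From the probability space to weighted sums over profiles -/

theorem popularityLaw_apply {α : Type*} [DecidableEq α] (D : α → ℝ) (A : Finset α)
    (hD : ∀ a ∈ A, 0 < D a) (l : List α) :
    popularityLaw D A hD l
      = if l ∈ preferenceLists A then ENNReal.ofReal (listWeight D l) else 0 := by
  induction hn : A.card generalizing A l with
  | zero =>
    obtain rfl := Finset.card_eq_zero.1 hn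
    rw [popularityLaw, dif_neg (by simp), PMF.pure_apply]
    have : l ∈ preferenceLists (∅ : Finset α) ↔ l = [] := by
      rw [mem_preferenceLists]; simp [eq_comm]
    by_cases h : l = []
    · rw [if_pos h, if_pos (this.2 h), h]; simp [listWeight]
    · rw [if_neg h, if_neg (this.not.2 h)]
  | succ n ih =>
    have hA : A.Nonempty := Finset.card_pos.1 (by omega)
    rw [popularityLaw, dif_pos hA, PMF.bind_apply, tsum_fintype]
    cases l with
    | nil =>
      rw [if_neg, Finset.sum_eq_zero]
      · intro a _
        rw [PMF.map_apply]
        simp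
      · intro h
        obtain ⟨a, ha⟩ := hA
        exact absurd ((mem_of_mem_preferenceLists h).2 ha) (by simp)
    | cons b k =>
      have hterm : ∀ a : A, popularityDraw D A hA hD a *
          ((popularityLaw D (A.erase a) (fun b hb => hD b (Finset.mem_of_mem_erase hb))).map
            (fun l => (a : α) :: l)) (b :: k)
          = if (a : α) = b then ENNReal.ofReal (D b / ∑ x ∈ A, D x) *
            (if k ∈ preferenceLists (A.erase b) then ENNReal.ofReal (listWeight D k) else 0)
            else 0 := by
        intro a
        rw [PMF.map_apply, tsum_eq_single k]
        · by_cases h : (a : α) = b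
          · have ha : popularityDraw D A hA hD a = ENNReal.ofReal (D a / ∑ x ∈ A, D x) := rfl
            rw [if_pos h, if_pos (by rw [h]),
              ih _ _ _ (by rw [Finset.card_erase_of_mem a.2, hn]; rfl), ha, h]
          · rw [if_neg h, if_neg (by simpa using fun h' => h h'.symm), mul_zero]
        · intro k' hk'
          rw [if_neg]
          simp only [List.cons.injEq, not_and]
          exact fun _ h => hk' h.symm
      rw [Finset.sum_congr rfl fun a _ => hterm a,
        Finset.sum_coe_sort A (fun a => if a = b then ENNReal.ofReal (D b / ∑ x ∈ A, D x) *
            (if k ∈ preferenceLists (A.erase b) then ENNReal.ofReal (listWeight D k) else 0)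
            else 0), Finset.sum_ite_eq']
      by_cases hb : b ∈ A
      · by_cases hk : k ∈ preferenceLists (A.erase b)
        · rw [if_pos hb, if_pos hk, if_pos (cons_mem_preferenceLists.2 ⟨hb, hk⟩),
            listWeight, sum_map_of_mem_preferenceLists D (cons_mem_preferenceLists.2 ⟨hb, hk⟩), ENNReal.ofReal_mul
            (div_nonneg (hD b hb).le (Finset.sum_nonneg fun x hx => (hD x hx).le))]
        · rw [if_pos hb, if_neg hk, if_neg fun h => hk (cons_mem_preferenceLists.1 h).2, mul_zero]
      · rw [if_neg hb, if_neg fun h => hb (cons_mem_preferenceLists.1 h).1]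

theorem log_sub_log_le_log_popularityRatio {M W : Type*} [Fintype W] [DecidableEq M]
    {A : W → Finset M} {D : W → M → ℝ}
    (hD : ∀ w, ∀ m ∈ A w, 0 < D w m) {m : M} {v w : W} (hv : m ∈ A v) (hw : m ∈ A w) :
    Real.log (D w m) - Real.log (D v m) ≤ Real.log (popularityRatio A D m) := by
  have hv' : v ∈ Finset.univ.filter fun w => m ∈ A w := by simpa using hv
  have hw' : w ∈ Finset.univ.filter fun w => m ∈ A w := by simpa using hw
  have hne : (Finset.univ.filter fun w => m ∈ A w).Nonempty := ⟨v, hv'⟩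
  have hinf : 0 < (Finset.univ.filter fun w => m ∈ A w).inf' hne (fun w => D w m) :=
    (Finset.lt_inf'_iff hne).2 fun u hu => hD u m (Finset.mem_filter.1 hu).2
  rw [popularityRatio, dif_pos hne, ← Real.log_div (hD w m hw).ne' (hD v m hv).ne']
  refine Real.log_le_log (div_pos (hD w m hw) (hD v m hv)) ?_
  have h1 := Finset.le_sup' (fun w => D w m) hw'
  exact div_le_div₀ ((hD w m hw).le.trans h1) h1 hinf (Finset.inf'_le (fun w => D w m) hv')

theorem log_popularityRatio_nonneg {M W : Type*} [Fintype W] [DecidableEq M]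
    {A : W → Finset M} {D : W → M → ℝ}
    (hD : ∀ w, ∀ m ∈ A w, 0 < D w m) (m : M) : 0 ≤ Real.log (popularityRatio A D m) := by
  by_cases h : ∃ w, m ∈ A w
  · obtain ⟨w, hw⟩ := h
    simpa using log_sub_log_le_log_popularityRatio hD hw hw
  · rw [popularityRatio, dif_neg]
    · simp
    · rintro ⟨w, hw⟩
      exact h ⟨w, (Finset.mem_filter.1 hw).2⟩

section

variable {M W Ω : Type*} [Fintype W] [DecidableEq M] [DecidableEq W]

/-- The mean of `f` over independent preference lists of the women. -/
noncomputable def profileMean (D : W → M → ℝ) (A : W → Finset M) (f : (W → List M) → ℝ) : ℝ :=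
  ∑ ℓ ∈ Fintype.piFinset fun w => preferenceLists (A w), (∏ w, listWeight (D w) (ℓ w)) * f ℓ

theorem integral_eq_profileMean [Fintype M] [MeasurableSpace Ω] (P : Measure Ω)
    [IsProbabilityMeasure P]
    (A : W → Finset M) (D : W → M → ℝ) (hD : ∀ w, ∀ m ∈ A w, 0 < D w m) (L : W → Ω → List M)
    (hL : ∀ w, HasPopularityPreferences P (L w) (D w) (A w) (hD w))
    (hindep : iIndepFun (m := fun _ => (⊤ : MeasurableSpace (List M))) L P)
    (f : (W → List M) → ℝ) :
    Integrable (fun ω => f fun w => L w ω) P ∧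
      ∫ ω, f (fun w => L w ω) ∂P = profileMean D A f := by
  set T := Fintype.piFinset fun w => preferenceLists (A w) with hT
  set E : (W → List M) → Set Ω := fun ℓ => ⋂ w, L w ⁻¹' {ℓ w} with hE
  have hmemE : ∀ ℓ ω, ω ∈ E ℓ ↔ (fun w => L w ω) = ℓ := fun ℓ ω => by
    simp [hE, funext_iff]
  have hEmeas : ∀ ℓ, MeasurableSet (E ℓ) := fun ℓ =>
    MeasurableSet.iInter fun w => (hL w (ℓ w)).1
  have hEP : ∀ ℓ ∈ T, P.real (E ℓ) = ∏ w, listWeight (D w) (ℓ w) := by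
    intro ℓ hℓ
    rw [hT, Fintype.mem_piFinset] at hℓ
    have h := hindep.measure_inter_preimage_eq_mul Finset.univ (sets := fun w => {ℓ w})
      (fun _ _ => MeasurableSpace.measurableSet_top)
    simp only [Finset.mem_univ, Set.iInter_true] at h
    rw [Measure.real, hE, h, ENNReal.toReal_prod]
    refine Finset.prod_congr rfl fun w _ => ?_
    rw [(hL w (ℓ w)).2, popularityLaw_apply, if_pos (hℓ w),
      ENNReal.toReal_ofReal (listWeight_nonneg_of_mem (hD w) (hℓ w))]
  have hae : ∀ᵐ ω ∂P, (fun w => L w ω) ∈ T := by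
    have h : ∀ w, ∀ᵐ ω ∂P, L w ω ∈ preferenceLists (A w) := by
      intro w
      -- Lists over the finite type `M` are countable, so the null events for single lists can be
      -- combined.
      have : ∀ l : List M, ∀ᵐ ω ∂P, L w ω = l → l ∈ preferenceLists (A w) := by
        intro l
        by_cases hl : l ∈ preferenceLists (A w)
        · exact Filter.Eventually.of_forall fun _ _ => hl
        · have h0 : P (L w ⁻¹' {l}) = 0 := by rw [(hL w l).2, popularityLaw_apply, if_neg hl]
          filter_upwards [measure_eq_zero_iff_ae_notMem.1 h0] with ω hω h
          exact absurd h hω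
      filter_upwards [ae_all_iff.2 this] with ω hω using hω _ rfl
    filter_upwards [ae_all_iff.2 h] with ω hω
    exact Fintype.mem_piFinset.2 hω
  have heq : (fun ω => f fun w => L w ω) =ᵐ[P]
      fun ω => ∑ ℓ ∈ T, (E ℓ).indicator (fun _ => f ℓ) ω := by
    filter_upwards [hae] with ω hω
    rw [Finset.sum_eq_single_of_mem _ hω]
    · rw [Set.indicator_of_mem ((hmemE _ ω).2 rfl)]
    · intro ℓ _ hne
      exact Set.indicator_of_notMem (fun h => hne ((hmemE ℓ ω).1 h).symm) _
  have hint : ∀ ℓ ∈ T, Integrable ((E ℓ).indicator fun _ => f ℓ) P := fun ℓ _ =>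
    (integrable_const _).indicator (hEmeas ℓ)
  refine ⟨(integrable_finsetSum T hint).congr heq.symm, ?_⟩
  rw [integral_congr_ae heq, integral_finsetSum T hint]
  refine Finset.sum_congr rfl fun ℓ hℓ => ?_
  rw [integral_indicator_const _ (hEmeas ℓ), hEP ℓ hℓ, smul_eq_mul]

theorem profileMean_mono {D : W → M → ℝ} {A : W → Finset M} (hD : ∀ w, ∀ m ∈ A w, 0 < D w m)
    {f g : (W → List M) → ℝ}
    (h : ∀ ℓ : W → List M, (∀ w, ℓ w ∈ preferenceLists (A w)) → f ℓ ≤ g ℓ) :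
    profileMean D A f ≤ profileMean D A g :=
  Finset.sum_le_sum fun ℓ hℓ => by
    rw [Fintype.mem_piFinset] at hℓ
    exact mul_le_mul_of_nonneg_left (h ℓ hℓ)
      (Finset.prod_nonneg fun w _ => listWeight_nonneg_of_mem (hD w) (hℓ w))

theorem profileMean_sum {ι : Type*} (D : W → M → ℝ) (A : W → Finset M) (s : Finset ι)
    (f : ι → (W → List M) → ℝ) :
    profileMean D A (fun ℓ => ∑ i ∈ s, f i ℓ) = ∑ i ∈ s, profileMean D A (f i) := by
  simp only [profileMean, Finset.mul_sum]
  exact Finset.sum_comm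

/-- Drawing the list of `w` anew does not change the mean. -/
theorem profileMean_resample {D : W → M → ℝ} {A : W → Finset M}
    (hD : ∀ w, ∀ m ∈ A w, 0 < D w m) (w : W) (f : (W → List M) → ℝ) :
    profileMean D A (fun ℓ => listMean (D w) (A w) fun l => f (Function.update ℓ w l))
      = profileMean D A f := by
  have h1 : profileMean D A f
      = profileMean D A (fun ℓ => listMean (D w) (A w) fun _ => f ℓ) := by
    simp only [listMean_const (hD w)]
  rw [h1]
  simp only [profileMean, listMean, Finset.mul_sum]
  rw [← Finset.sum_product', ← Finset.sum_product']
  have hprod : ∀ (ℓ : W → List M) (l : List M),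
      (∏ v, listWeight (D v) (Function.update ℓ w l v)) * listWeight (D w) (ℓ w)
        = (∏ v, listWeight (D v) (ℓ v)) * listWeight (D w) l := by
    intro ℓ l
    rw [← Finset.mul_prod_erase _ _ (Finset.mem_univ w),
      ← Finset.mul_prod_erase Finset.univ (fun v => listWeight (D v) (ℓ v)) (Finset.mem_univ w),
      Function.update_self]
    have : ∏ v ∈ Finset.univ.erase w, listWeight (D v) (Function.update ℓ w l v)
        = ∏ v ∈ Finset.univ.erase w, listWeight (D v) (ℓ v) :=
      Finset.prod_congr rfl fun v hv => by
        rw [Function.update_of_ne (Finset.ne_of_mem_erase hv)]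
    rw [this]; ring
  have hmem : ∀ p ∈ (Fintype.piFinset fun w => preferenceLists (A w)) ×ˢ preferenceLists (A w),
      (Function.update p.1 w p.2, p.1 w)
        ∈ (Fintype.piFinset fun w => preferenceLists (A w)) ×ˢ preferenceLists (A w) := by
    rintro ⟨ℓ, l⟩ h
    rw [Finset.mem_product, Fintype.mem_piFinset] at h ⊢
    refine ⟨fun v => ?_, h.1 w⟩
    by_cases hv : v = w
    · subst hv
      simpa using h.2
    · simpa [hv] using h.1 v
  -- Exchanging the old and the new list of w is an involution that preserves the product weight.
  refine Finset.sum_nbij' (fun p => (Function.update p.1 w p.2, p.1 w))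
    (fun p => (Function.update p.1 w p.2, p.1 w)) hmem hmem ?_ ?_ ?_
  · rintro ⟨ℓ, l⟩ _; simp
  · rintro ⟨ℓ, l⟩ _; simp
  · rintro ⟨ℓ, l⟩ _
    dsimp only
    rw [← mul_assoc, ← mul_assoc, hprod]

/-! ### Summation over the women -/

theorem ncard_stablePairs_le [Fintype M] (menPref : M → List W) (ℓ : W → List M) :
    (stablePairs menPref ℓ).ncard ≤ ∑ w, (stableHusbands menPref ℓ w).card := by
  classical
  have hsub : stablePairs menPref ℓ ⊆ ((Finset.univ.sigma fun w => stableHusbands menPref ℓ w).image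
      fun p => (p.2, p.1) : Finset (M × W)) := by
    rintro ⟨m, w⟩ h
    rw [Finset.coe_image]
    exact ⟨⟨w, m⟩, by simpa using mem_stableHusbands.2 (exists_fixedPoint_of_mem_stablePairs h),
      rfl⟩
  refine (Set.ncard_le_ncard hsub (Finset.finite_toSet _)).trans ?_
  rw [Set.ncard_coe_finset, ← Finset.card_sigma]
  exact Finset.card_image_le

/-- The women gain little, in total, between the stable matching that is best for the men and the
one that is best for the women, since the same men are matched. -/
theorem sum_heldSum_le [Fintype M] {menPref : M → List W} {ℓ : W → List M} {A : W → Finset M}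
    (hℓ : ∀ w, ℓ w ∈ preferenceLists (A w)) {D : W → M → ℝ} {b : W → ℝ} {B : ℝ} {r : M → ℝ}
    (hr0 : ∀ m, 0 ≤ r m)
    (hr : ∀ m v w, m ∈ A v → m ∈ A w → Real.log (D w m) - Real.log (D v m) ≤ r m)
    (hB : ∀ k : W → ℕ, (∀ w, k w ≤ 1) → ∑ w, k w ≤ min (Fintype.card M) (Fintype.card W) →
      ∑ w, (k w : ℝ) * b w ≤ B) :
    ∑ w, (heldSum menPref (menOptimal menPref ℓ) w (fun x => b w - Real.log (D w x))
        + heldSum menPref (womenOptimal menPref ℓ) w (fun x => Real.log (D w x)))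
      ≤ B + ∑ m, r m := by
  classical
  set F := menOptimal menPref ℓ with hF
  set G := womenOptimal menPref ℓ with hG
  have hFfix := rejectStep_menOptimal (menPref := menPref) (ℓ := ℓ)
  have hGfix := rejectStep_womenOptimal (menPref := menPref) (ℓ := ℓ)
  -- The constants `b w` are counted by woman and the logarithms regrouped by man.
  have hsplit : ∑ w, (heldSum menPref F w (fun x => b w - Real.log (D w x))
        + heldSum menPref G w (fun x => Real.log (D w x)))
      = ∑ w, ((Finset.univ.filter fun m => Holds menPref F m w).card : ℝ) * b w
        + ∑ m, (∑ w, (if Holds menPref G m w then Real.log (D w m) else 0)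
          - ∑ w, (if Holds menPref F m w then Real.log (D w m) else 0)) := by
    rw [Finset.sum_sub_distrib, Finset.sum_comm (s := (Finset.univ : Finset M)),
      Finset.sum_comm (s := (Finset.univ : Finset M)), ← Finset.sum_sub_distrib,
      ← Finset.sum_add_distrib]
    refine Finset.sum_congr rfl fun w _ => ?_
    rw [← Finset.sum_boole, Finset.sum_mul, heldSum, heldSum]
    have : ∀ m, (if Holds menPref F m w then b w - Real.log (D w m) else 0)
        = (if Holds menPref F m w then 1 else 0) * b w
          - if Holds menPref F m w then Real.log (D w m) else 0 := fun m => by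
      split_ifs <;> ring
    rw [Finset.sum_congr rfl fun m _ => this m, Finset.sum_sub_distrib]
    ring
  rw [hsplit]
  refine add_le_add (hB _ (fun w => card_holds_le_one hFfix rfl) ?_)
    (Finset.sum_le_sum fun m _ => ?_)
  · rw [← card_exists_holds]
    refine le_min (Finset.card_le_univ _) ?_
    rw [card_exists_holds]
    calc _ ≤ ∑ _v : W, 1 := Finset.sum_le_sum fun v _ => card_holds_le_one hFfix rfl
      _ = _ := by simp
  · have hone : ∀ H : Set (M × W), ∀ v, Holds menPref H m v →
        ∑ w, (if Holds menPref H m w then Real.log (D w m) else 0) = Real.log (D v m) := by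
      intro H v hv
      rw [Finset.sum_eq_single v, if_pos hv]
      · intro w _ hw
        exact if_neg fun h => hw (h.unique_right hv)
      · simp
    -- Each man is matched in both extreme outcomes or in neither: two logarithms compare through
    -- `hr`, or both sums vanish.
    have hiff := exists_holds_iff_of_subset hFfix hGfix
      (menOptimal_subset_womenOptimal (menPref := menPref)) ℓ (fun _ => rfl) m
    by_cases h : ∃ v, Holds menPref F m v
    · obtain ⟨w, hw⟩ := hiff.1 h
      obtain ⟨v, hv⟩ := h
      rw [hone G w hw, hone F v hv]
      exact hr m v w ((mem_of_mem_preferenceLists (hℓ v)).1 (hv.best hFfix rfl).1)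
        ((mem_of_mem_preferenceLists (hℓ w)).1 (hw.best hGfix rfl).1)
    · have h' := fun hc => h (hiff.2 hc)
      rw [Finset.sum_eq_zero fun w _ => if_neg fun hc => h' ⟨w, hc⟩,
        Finset.sum_eq_zero fun w _ => if_neg fun hc => h ⟨w, hc⟩, sub_zero]
      exact hr0 m

/-- The general bound on the expected number of stable pairs, in which woman `w` contributes
`1 + log (c w)` when she is matched and man `m` contributes `r m`. -/
theorem integral_ncard_stablePairs_le [Fintype M] [MeasurableSpace Ω] (P : Measure Ω)
    [IsProbabilityMeasure P] (menPref : M → List W)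
    (A : W → Finset M) (D : W → M → ℝ) (hD : ∀ w, ∀ m ∈ A w, 0 < D w m) (L : W → Ω → List M)
    (hL : ∀ w, HasPopularityPreferences P (L w) (D w) (A w) (hD w))
    (hindep : iIndepFun (m := fun _ => (⊤ : MeasurableSpace (List M))) L P)
    {c : W → ℝ} {B : ℝ} {r : M → ℝ}
    (hc : ∀ w, ∀ k : ℕ, k ≤ (A w).card → k ≤ min (Fintype.card M) (Fintype.card W) →
      (k : ℝ) ≤ c w)
    (hr0 : ∀ m, 0 ≤ r m)
    (hr : ∀ m v w, m ∈ A v → m ∈ A w → Real.log (D w m) - Real.log (D v m) ≤ r m)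
    (hB : ∀ k : W → ℕ, (∀ w, k w ≤ 1) → ∑ w, k w ≤ min (Fintype.card M) (Fintype.card W) →
      ∑ w, (k w : ℝ) * (1 + Real.log (c w)) ≤ B) :
    ∫ ω, ((stablePairs menPref (fun w => L w ω)).ncard : ℝ) ∂P ≤ B + ∑ m, r m := by
  have hmean := fun f => (integral_eq_profileMean P A D hD L hL hindep f).2
  rw [hmean fun ℓ => ((stablePairs menPref ℓ).ncard : ℝ)]
  calc profileMean D A (fun ℓ => ((stablePairs menPref ℓ).ncard : ℝ))
      ≤ profileMean D A (fun ℓ => ∑ w, ((stableHusbands menPref ℓ w).card : ℝ)) :=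
        profileMean_mono hD fun ℓ _ => by exact_mod_cast ncard_stablePairs_le menPref ℓ
    _ = ∑ w, profileMean D A (fun ℓ => ((stableHusbands menPref ℓ w).card : ℝ)) :=
        profileMean_sum D A _ _
    _ ≤ ∑ w, profileMean D A (fun ℓ =>
          heldSum menPref (menOptimal menPref ℓ) w (fun x => 1 + Real.log (c w) - Real.log (D w x))
          + heldSum menPref (womenOptimal menPref ℓ) w (fun x => Real.log (D w x))) := by
        refine Finset.sum_le_sum fun w _ => ?_
        -- Redrawing the list of w puts the lists of the other women in the role of the fixed
        -- profile in the one-woman bound.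
        rw [← profileMean_resample hD w, ← profileMean_resample hD w (fun ℓ =>
          heldSum menPref (menOptimal menPref ℓ) w _ + heldSum menPref (womenOptimal menPref ℓ) w _)]
        exact profileMean_mono hD fun ℓ _ =>
          listMean_card_stableHusbands_le ℓ w (hD w) (hc w)
    _ = profileMean D A (fun ℓ => ∑ w, (heldSum menPref (menOptimal menPref ℓ) w
            (fun x => 1 + Real.log (c w) - Real.log (D w x))
          + heldSum menPref (womenOptimal menPref ℓ) w (fun x => Real.log (D w x)))) :=
        (profileMean_sum D A _ _).symm
    _ ≤ profileMean D A (fun _ => B + ∑ m, r m) :=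
        profileMean_mono hD fun ℓ hℓ => sum_heldSum_le hℓ hr0 hr hB
    _ = B + ∑ m, r m := by rw [← hmean]; simp

end

theorem mainTheorem5 {M W Ω : Type*} [Fintype M] [Fintype W] [DecidableEq M] [DecidableEq W]
    [MeasurableSpace Ω] (P : Measure Ω) [IsProbabilityMeasure P]
    -- arbitrary preference lists of the men
    (menPref : M → List W) (hmen : ∀ m, (menPref m).Nodup)
    -- acceptable men and popularities, for each woman
    (A : W → Finset M) (hA : ∀ w, 1 ≤ (A w).card)
    (D : W → M → ℝ) (hD : ∀ w, ∀ m ∈ A w, 0 < D w m)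
    -- random preference lists of the women, drawn independently from the popularities
    (L : W → Ω → List M)
    (hL : ∀ w, HasPopularityPreferences P (L w) (D w) (A w) (hD w))
    (hindep : iIndepFun (m := fun _ => (⊤ : MeasurableSpace (List M))) L P) :
    Integrable (fun ω => ((stablePairs menPref (fun w => L w ω)).ncard : ℝ)) P ∧
    (∫ ω, ((stablePairs menPref (fun w => L w ω)).ncard : ℝ) ∂P
      ≤ (min (Fintype.card M) (Fintype.card W) : ℕ)
        + ∑ w, Real.log ((A w).card : ℝ)
        + ∑ m, Real.log (popularityRatio A D m)) ∧
    ((∀ m w w', m ∈ A w → m ∈ A w' → D w m = D w' m) →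
      ∫ ω, ((stablePairs menPref (fun w => L w ω)).ncard : ℝ) ∂P
        ≤ (min (Fintype.card M) (Fintype.card W) : ℕ)
          + (min (Fintype.card M) (Fintype.card W) : ℕ)
            * Real.log (min (Fintype.card M) (Fintype.card W) : ℕ)) := by
  refine ⟨(integral_eq_profileMean P A D hD L hL hindep
    (fun ℓ => ((stablePairs menPref ℓ).ncard : ℝ))).1, ?_, fun hag => ?_⟩
  -- With c = d_w, the 1 in each matched woman's share adds up to at most N, and the logarithms are
  -- bounded by the sum over all women.
  · refine integral_ncard_stablePairs_le P menPref A D hD L hL hindep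
      (c := fun w => ((A w).card : ℝ)) (fun w k hk _ => Nat.cast_le.2 hk)
      (log_popularityRatio_nonneg hD)
      (fun m v w hv hw => log_sub_log_le_log_popularityRatio hD hv hw) fun k hk1 hkN => ?_
    simp only [mul_add, mul_one, Finset.sum_add_distrib]
    refine add_le_add (by exact_mod_cast hkN) (Finset.sum_le_sum fun w _ => ?_)
    have hlog : 0 ≤ Real.log ((A w).card : ℝ) := Real.log_natCast_nonneg _
    have hk : (k w : ℝ) ≤ 1 := by exact_mod_cast hk1 w
    exact mul_le_of_le_one_left hlog hk
  -- Agreement of the women makes every man's contribution zero; with c = N, at most N matched women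
  -- contribute 1 + log N each.
  · have h := integral_ncard_stablePairs_le P menPref A D hD L hL hindep
      (c := fun _ => ((min (Fintype.card M) (Fintype.card W) : ℕ) : ℝ)) (r := fun _ => 0)
      (fun w k _ hk => Nat.cast_le.2 hk) (fun _ => le_rfl)
      (fun m v w hv hw => by rw [hag m v w hv hw, sub_self])
      (B := (min (Fintype.card M) (Fintype.card W) : ℕ)
          + (min (Fintype.card M) (Fintype.card W) : ℕ)
            * Real.log (min (Fintype.card M) (Fintype.card W) : ℕ)) fun k _ hkN => by
        have hkN' : ∑ w, (k w : ℝ) ≤ (min (Fintype.card M) (Fintype.card W) : ℕ) := by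
          exact_mod_cast hkN
        rw [← Finset.sum_mul, mul_add, mul_one]
        exact add_le_add hkN' (mul_le_mul_of_nonneg_right hkN' (Real.log_natCast_nonneg _))
    simpa using h
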